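/- Let $(M,g)$ be a smooth $n$-dimensional pseudo-Riemannian manifold of arbitrary signature, with contravariant metric $G=g^{-1}$ and Levi-Civita connection $\nabla$. A \emph{concircular tensor} is a smooth symmetric contravariant 2-tensor $L$ with $\nabla_k L_{ij}=\alpha_{(i}g_{j)k}$ for some covector field $\alpha$; it is an \emph{orthogonal concircular tensor} (OCT) if the $(1,1)$-tensor $L^i{}_j$ is point-wise diagonalizable over $\mathbb R$, and it is \emph{non-trivial} if it is not a multiple of $G$ when $n>1$. \emph{Associated product.} Coordinates on a connected open set $U$ are product coordinates $(x_0,x_1,\dots,x_k)$ of the product manifold $M_0\times M_1\times\dots\times M_k$ associated with the OCT $L$ if $U$ is the product of its projections to the groups of coordinates $x_0,\dots,x_k$; each coordinate field $\partial_a$ belonging to $x_0$ is an eigenvector of $L$ whose eigenvalue is simple at every point of $U$; and, for $1\le I\le k$, $\dim M_I>1$ and the fields $\partial_i$ belonging to $x_I$ span at every point the eigenspace of $L$ for a constant eigenvalue $e_I$, the $e_I$ being pairwise distinct. The factor $M_I$ is identified with a leaf (all coordinates outside $x_I$ held fixed) and carries the induced metric $g|_{M_I}$. \emph{KEM coordinates}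 are defined recursively: coordinates are Kalnins--Eisenhart--Miller (KEM) coordinates if, in a neighbourhood of each point, they are product coordinates $(x_0,x_1,\dots,x_k)$ of the product manifold associated with a non-trivial OCT and, for every $1\le I\le k$, $x_I$ are KEM coordinates on $(M_I,g|_{M_I})$. \textbf{Proposition.} Let $(x^1,\dots,x^n)$ be a coordinate system on an open subset of $M$ which is a system of KEM coordinates. Then 1. the coordinates are orthogonal: $g_{ij}=0$ for $i\ne j$; 2. the coordinates are separable: every point of the coordinate domain has an open neighbourhood $V$ on which the geodesic Hamilton--Jacobi equation $\tfrac12 g^{ij}\,\partial_iS\,\partial_jS=E$ has a smooth complete integral of the form $S(x,c)=\sum_{i=1}^n W_i(x^i,c)$, where $c$ ranges over a non-empty open subset of $\mathbb R^n$, $E=E(c)$, and $\det\left(\partial^2S/\partial x^i\partial c^j\right)\neq0$; 3. the coordinates have diagonal curvature: the Riemann curvature tensor satisfies $R_{ijik}=0$ for all $i$ and all $j\ne k$, in the coordinate induced basis. -/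

import Mathlib

open scoped Manifold ContDiff

noncomputable section

namespace KEM

/-! ### Tensor calculus in a coordinate domain

A coordinate domain is a subset `U` of `ι → ℝ`, and a (pseudo-Riemannian) metric on it is given by
its matrix of components `g x i j = g_{ij}(x)`. -/

section Coordinates

variable {ι : Type} [Fintype ι] [DecidableEq ι]

/-- The partial derivative `∂f/∂xᵢ`. -/
def pderiv (i : ι) (f : (ι → ℝ) → ℝ) (x : ι → ℝ) : ℝ :=
  fderiv ℝ f x (Pi.single i 1)

/-- The Christoffel symbol `Γ^m_{ij}` of the Levi-Civita connection of `g`. -/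
def christoffel (g : (ι → ℝ) → Matrix ι ι ℝ) (m i j : ι) (x : ι → ℝ) : ℝ :=
  (1 / 2) * ∑ l, (g x)⁻¹ m l *
    (pderiv i (fun y => g y l j) x + pderiv j (fun y => g y l i) x - pderiv l (fun y => g y i j) x)

/-- The components `R_{ijkl} = ⟨R(∂_k, ∂_l)∂_j, ∂_i⟩` of the Riemann curvature tensor, where
`R(X, Y)Z = ∇_X ∇_Y Z - ∇_Y ∇_X Z - ∇_{[X, Y]} Z`. -/
def riemann (g : (ι → ℝ) → Matrix ι ι ℝ) (i j k l : ι) (x : ι → ℝ) : ℝ :=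
  ∑ m, g x i m *
    (pderiv k (christoffel g m l j) x - pderiv l (christoffel g m k j) x
      + ∑ r, (christoffel g m k r x * christoffel g r l j x
        - christoffel g m l r x * christoffel g r k j x))

/-- The covariant derivative `∇_k T_{ij}` of a covariant 2-tensor. -/
def covDeriv (g T : (ι → ℝ) → Matrix ι ι ℝ) (k i j : ι) (x : ι → ℝ) : ℝ :=
  pderiv k (fun y => T y i j) x
    - ∑ m, christoffel g m k i x * T x m j - ∑ m, christoffel g m k j x * T x i m

/-- The covariant components `L_{ij} = g_{ip} L^{pq} g_{qj}` of a contravariant tensor. -/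
def lower (g L : (ι → ℝ) → Matrix ι ι ℝ) (x : ι → ℝ) : Matrix ι ι ℝ := g x * L x * g x

/-- The mixed components `L^i_j = L^{ip} g_{pj}` of a contravariant tensor. -/
def mixed (g L : (ι → ℝ) → Matrix ι ι ℝ) (x : ι → ℝ) : Matrix ι ι ℝ := L x * g x

/-- `L` (contravariant components `L^{ij}`) is a concircular tensor on `U`: a smooth symmetric tensor
with `∇_k L_{ij} = α_{(i} g_{j)k}` for some covector field `α`. -/
structure IsConcircular (U : Set (ι → ℝ)) (g L : (ι → ℝ) → Matrix ι ι ℝ) : Prop where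
  smooth : ∀ i j, ContDiffOn ℝ ∞ (fun x => L x i j) U
  symm : ∀ x ∈ U, (L x).IsSymm
  eqn : ∃ α : (ι → ℝ) → ι → ℝ, ∀ x ∈ U, ∀ i j k,
    covDeriv g (lower g L) k i j x = (1 / 2) * (α x i * g x j k + α x j * g x i k)

/-- An orthogonal concircular tensor (OCT): its (1,1)-tensor is point-wise diagonalizable (over `ℝ`). -/
structure IsOCT (U : Set (ι → ℝ)) (g L : (ι → ℝ) → Matrix ι ι ℝ) : Prop
    extends IsConcircular U g L where
  diagonalizable : ∀ x ∈ U, ∃ (P : Matrix ι ι ℝ) (d : ι → ℝ),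
    IsUnit P.det ∧ mixed g L x * P = P * Matrix.diagonal d

/-- `L` is non-trivial: not a multiple of the (contravariant) metric when the dimension exceeds 1. -/
def IsNontrivial (U : Set (ι → ℝ)) (g L : (ι → ℝ) → Matrix ι ι ℝ) : Prop :=
  1 < Fintype.card ι → ¬ ∃ f : (ι → ℝ) → ℝ, ∀ x ∈ U, L x = f x • (g x)⁻¹

/-- The coordinates on `U` are product coordinates `(x_0, x_1, …, x_k)` for the product manifold
`M_0 × M_1 × ⋯ × M_k` associated with the OCT `L`; here `b i = I` says that the `i`-th coordinate is
one of the coordinates `x_I` of the factor `M_I`. The coordinates `x_0` are those induced by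
`L` on `M_0`, i.e. each `∂_a` with `b a = 0` spans an eigenspace of `L`; the leaves of the `I`-th
foliation, `I ≠ 0`, are tangent to the eigenspace with constant eigenvalue `e I`. -/
structure IsAssociatedProduct (U : Set (ι → ℝ)) (g L : (ι → ℝ) → Matrix ι ι ℝ)
    {k : ℕ} (b : ι → Fin (k + 1)) : Prop where
  isOpen : IsOpen U
  connected : IsConnected U
  /-- `U` is the product of its projections to the factors. -/
  product : ∀ x : ι → ℝ, (∀ I, ∃ y ∈ U, ∀ j, b j = I → y j = x j) → x ∈ U
  /-- `dim M_I > 1` for `I > 0`. -/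
  dim : ∀ I, I ≠ 0 → 1 < Fintype.card {j // b j = I}
  eigen : ∃ (lam : (ι → ℝ) → ι → ℝ) (e : Fin (k + 1) → ℝ), ∀ x ∈ U,
    mixed g L x = Matrix.diagonal (lam x) ∧
    (∀ i, b i ≠ 0 → lam x i = e (b i)) ∧
    (∀ i j, lam x i = lam x j ↔ i = j ∨ (b i = b j ∧ b i ≠ 0))

/-- The point with coordinates `y` in the `I`-th factor and the coordinates of `p` in the others. -/
def leafPoint {k : ℕ} (b : ι → Fin (k + 1)) (I : Fin (k + 1)) (p : ι → ℝ)
    (y : {j // b j = I} → ℝ) : ι → ℝ :=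
  fun j => if h : b j = I then y ⟨j, h⟩ else p j

/-- The factor `M_I`, realized as the leaf through `p`, in the coordinates `x_I`. -/
def leafDomain {k : ℕ} (b : ι → Fin (k + 1)) (I : Fin (k + 1)) (p : ι → ℝ) (U : Set (ι → ℝ)) :
    Set ({j // b j = I} → ℝ) :=
  leafPoint b I p ⁻¹' U

/-- The metric `g|_{M_I}` induced on the leaf through `p`, in the coordinates `x_I`. -/
def leafMetric {k : ℕ} (b : ι → Fin (k + 1)) (I : Fin (k + 1)) (p : ι → ℝ)
    (g : (ι → ℝ) → Matrix ι ι ℝ) :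
    ({j // b j = I} → ℝ) → Matrix {j // b j = I} {j // b j = I} ℝ :=
  fun y => (g (leafPoint b I p y)).submatrix Subtype.val Subtype.val

end Coordinates

/-- The coordinates on `U`, with metric components `g`, are Kalnins-Eisenhart-Miller coordinates:
locally they are product coordinates of the product manifold of a non-trivial OCT, with KEM
coordinates on each factor `M_I`, `I ≥ 1` (a leaf through some point `p I`). -/
inductive IsKEM : {ι : Type} → [Fintype ι] → [DecidableEq ι] →
    Set (ι → ℝ) → ((ι → ℝ) → Matrix ι ι ℝ) → Prop
  | ofOCT {ι : Type} [Fintype ι] [DecidableEq ι] {U : Set (ι → ℝ)}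
      {g : (ι → ℝ) → Matrix ι ι ℝ} (L : (ι → ℝ) → Matrix ι ι ℝ)
      (oct : IsOCT U g L) (nontrivial : IsNontrivial U g L)
      {k : ℕ} (b : ι → Fin (k + 1)) (prod : IsAssociatedProduct U g L b)
      (p : Fin (k + 1) → ι → ℝ) (mem : ∀ I, p I ∈ U)
      (factor : ∀ I, I ≠ 0 → IsKEM (leafDomain b I (p I) U) (leafMetric b I (p I) g)) :
      IsKEM U g
  | ofLocal {ι : Type} [Fintype ι] [DecidableEq ι] {U : Set (ι → ℝ)}
      {g : (ι → ℝ) → Matrix ι ι ℝ} (V : (ι → ℝ) → Set (ι → ℝ))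
      (nhd : ∀ x ∈ U, IsOpen (V x) ∧ x ∈ V x ∧ V x ⊆ U)
      (kem : ∀ x ∈ U, IsKEM (V x) g) :
      IsKEM U g

section Conclusions

variable {ι : Type} [Fintype ι] [DecidableEq ι]

/-- `S (x, c)` is a complete integral, with parameters `c ∈ C` and energy `E c`, of the (geodesic)
Hamilton-Jacobi equation `(1/2) g^{ij} ∂_i S ∂_j S = E` on `V`. -/
structure IsCompleteIntegral (V C : Set (ι → ℝ)) (g : (ι → ℝ) → Matrix ι ι ℝ)
    (S : (ι → ℝ) → (ι → ℝ) → ℝ) (E : (ι → ℝ) → ℝ) : Prop where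
  smooth : ContDiffOn ℝ ∞ (fun q : (ι → ℝ) × (ι → ℝ) => S q.1 q.2) (V ×ˢ C)
  eqn : ∀ x ∈ V, ∀ c ∈ C,
    (1 / 2) * ∑ i, ∑ j, (g x)⁻¹ i j * pderiv i (fun y => S y c) x * pderiv j (fun y => S y c) x = E c
  complete : ∀ x ∈ V, ∀ c ∈ C,
    (Matrix.of fun i j => pderiv j (fun c' => pderiv i (fun y => S y c') x) c).det ≠ 0

/-- The coordinates are separable: near every point the Hamilton-Jacobi equation has a complete
integral of the form `S (x, c) = ∑ W_i (x_i, c)`. -/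
def IsSeparable (U : Set (ι → ℝ)) (g : (ι → ℝ) → Matrix ι ι ℝ) : Prop :=
  ∀ x₀ ∈ U, ∃ V : Set (ι → ℝ), IsOpen V ∧ x₀ ∈ V ∧ V ⊆ U ∧
    ∃ C : Set (ι → ℝ), IsOpen C ∧ C.Nonempty ∧
      ∃ (W : ι → ℝ → (ι → ℝ) → ℝ) (E : (ι → ℝ) → ℝ),
        IsCompleteIntegral V C g (fun x c => ∑ i, W i (x i) c) E

/-- The coordinates are orthogonal. -/
def IsOrthogonal (U : Set (ι → ℝ)) (g : (ι → ℝ) → Matrix ι ι ℝ) : Prop :=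
  ∀ x ∈ U, ∀ i j, i ≠ j → g x i j = 0

/-- The coordinates have diagonal curvature: `R_{ijik} = 0` for `j ≠ k`. -/
def IsDiagonalCurvature (U : Set (ι → ℝ)) (g : (ι → ℝ) → Matrix ι ι ℝ) : Prop :=
  ∀ x ∈ U, ∀ i j k, j ≠ k → riemann g i j i k x = 0

end Conclusions

/-! ### Coordinate systems on a pseudo-Riemannian manifold -/

/-- A smooth pseudo-Riemannian metric (of any signature) on a smooth `n`-manifold. -/
structure PseudoRiemannianMetric (n : ℕ) (M : Type*) [TopologicalSpace M]
    [ChartedSpace (EuclideanSpace ℝ (Fin n)) M] [IsManifold (𝓡 n) ∞ M] where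
  inner (x : M) : TangentSpace (𝓡 n) x →L[ℝ] TangentSpace (𝓡 n) x →L[ℝ] ℝ
  symm (x : M) (v w : TangentSpace (𝓡 n) x) : inner x v w = inner x w v
  nondegenerate (x : M) (v : TangentSpace (𝓡 n) x) (h : ∀ w, inner x v w = 0) : v = 0
  contMDiff : ContMDiff (𝓡 n)
    ((𝓡 n).prod 𝓘(ℝ, EuclideanSpace ℝ (Fin n) →L[ℝ] EuclideanSpace ℝ (Fin n) →L[ℝ] ℝ)) ∞
    (fun x => Bundle.TotalSpace.mk'
      (EuclideanSpace ℝ (Fin n) →L[ℝ] EuclideanSpace ℝ (Fin n) →L[ℝ] ℝ)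
      (E := fun x : M => TangentSpace (𝓡 n) x →L[ℝ] TangentSpace (𝓡 n) x →L[ℝ] ℝ) x (inner x))

section Manifold

variable {n : ℕ} {M : Type*} [TopologicalSpace M] [ChartedSpace (EuclideanSpace ℝ (Fin n)) M]
  [IsManifold (𝓡 n) ∞ M]

/-- A smooth (local) coordinate system `(x^1, …, x^n)` on `M`, with domain `φ.source`. -/
structure IsCoordinateSystem (φ : OpenPartialHomeomorph M (Fin n → ℝ)) : Prop where
  smooth : ContMDiffOn (𝓡 n) 𝓘(ℝ, Fin n → ℝ) ∞ φ φ.source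
  smooth_symm : ContMDiffOn 𝓘(ℝ, Fin n → ℝ) (𝓡 n) ∞ φ.symm φ.target

/-- The coordinate vector field `∂_i`, at the point with coordinates `y`. -/
def coordVector (φ : OpenPartialHomeomorph M (Fin n → ℝ)) (y : Fin n → ℝ) (i : Fin n) :
    TangentSpace (𝓡 n) (φ.symm y) :=
  mfderiv 𝓘(ℝ, Fin n → ℝ) (𝓡 n) φ.symm y (Pi.single i (1 : ℝ) : Fin n → ℝ)

/-- The components `g_{ij} = g(∂_i, ∂_j)` of the metric as functions of the coordinates. -/
def metricComponents (g : PseudoRiemannianMetric n M) (φ : OpenPartialHomeomorph M (Fin n → ℝ))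
    (y : Fin n → ℝ) : Matrix (Fin n) (Fin n) ℝ :=
  Matrix.of fun i j => g.inner (φ.symm y) (coordVector φ y i) (coordVector φ y j)

end Manifold

end KEM

end

/-!
In coordinates diagonalizing `L`, the equation `∇_k L_ij = α_(i g_j)k` says that each simple
eigenvalue `λ_a` depends on `x_a` only, that `g_aa` is a function of `x_a` times
`∏_{r ≠ a} (λ_a - λ_r)`, and that the metric of `M_I` is warped by `∏_a (e_I - λ_a)`. Orthogonality
and the Lamé equations, which for orthogonal coordinates express diagonal curvature, therefore pass
from the factors `M_I` to the product.

For separability, let `h_I` be the energies of the separated solutions on the factors and put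
`p_a² = ψ_a(x_a) f(λ_a)`, where `f(s)` is a polynomial, whose coefficients are the parameters
belonging to `M_0`, minus `∑_I h_I / (e_I - s)`. Lagrange interpolation at the `λ_a` makes the sum
of the `p_a² / g_aa` cancel the contributions `h_I / ∏_a (e_I - λ_a)` of the factors and leaves a
constant. The matrix `∂p/∂c` is block triangular with respect to the factors.
-/

namespace KEM

open scoped Topology

/-! ### Partial derivatives -/

section PartialDerivatives

variable {ι : Type} [DecidableEq ι] {U : Set (ι → ℝ)} {f h : (ι → ℝ) → ℝ} {x : ι → ℝ} {i j : ι}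

theorem pderiv_congr (hfh : f =ᶠ[𝓝 x] h) : pderiv i f x = pderiv i h x := by
  rw [pderiv, pderiv, hfh.fderiv_eq]

theorem pderiv_congr_of_eqOn (hU : IsOpen U) (hfh : Set.EqOn f h U) (hx : x ∈ U) :
    pderiv i f x = pderiv i h x :=
  pderiv_congr (hfh.eventuallyEq_of_mem (hU.mem_nhds hx))

theorem pderiv_const (c : ℝ) : pderiv i (fun _ : ι → ℝ => c) x = 0 := by
  simp [pderiv]

theorem pderiv_eq_zero_of_eqOn_const {c : ℝ} (hU : IsOpen U) (hf : ∀ y ∈ U, f y = c)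
    (hx : x ∈ U) : pderiv i f x = 0 := by
  rw [pderiv_congr_of_eqOn hU hf hx, pderiv_const]

section Finite

variable [Finite ι]

theorem pderiv_sub (hf : DifferentiableAt ℝ f x) (hh : DifferentiableAt ℝ h x) :
    pderiv i (fun y => f y - h y) x = pderiv i f x - pderiv i h x := by
  have := Fintype.ofFinite ι
  simp [pderiv, fderiv_fun_sub hf hh]

theorem pderiv_mul (hf : DifferentiableAt ℝ f x) (hh : DifferentiableAt ℝ h x) :
    pderiv i (fun y => f y * h y) x = pderiv i f x * h x + f x * pderiv i h x := by
  have := Fintype.ofFinite ι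
  simp only [pderiv, fderiv_fun_mul hf hh, add_apply, FunLike.coe_smul, Pi.smul_apply, smul_eq_mul]
  ring

theorem pderiv_comp {F : ℝ → ℝ} {F' : ℝ} (hF : HasDerivAt F F' (f x))
    (hf : DifferentiableAt ℝ f x) : pderiv i (fun y => F (f y)) x = F' * pderiv i f x := by
  have := Fintype.ofFinite ι
  have hFf := (hF.comp_hasFDerivAt x hf.hasFDerivAt).fderiv
  simp only [Function.comp_def] at hFf
  simp [pderiv, hFf]

theorem pderiv_div_const (hf : DifferentiableAt ℝ f x) (c : ℝ) :
    pderiv i (fun y => f y / c) x = pderiv i f x / c :=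
  (pderiv_comp ((hasDerivAt_id' (f x)).div_const c) hf).trans (one_div_mul_eq_div c _)

theorem pderiv_sum {κ : Type*} {s : Finset κ} {F : κ → (ι → ℝ) → ℝ}
    (hF : ∀ a ∈ s, DifferentiableAt ℝ (F a) x) :
    pderiv i (fun y => ∑ a ∈ s, F a y) x = ∑ a ∈ s, pderiv i (F a) x := by
  have := Fintype.ofFinite ι
  simp [pderiv, fderiv_fun_sum hF]

/-- Logarithmic derivatives are replaced by factors `μ a`, so that the `F a` may vanish. -/
theorem pderiv_prod_of_log {κ : Type*} {s : Finset κ} {F : κ → (ι → ℝ) → ℝ} {μ : κ → ℝ}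
    (hF : ∀ a ∈ s, DifferentiableAt ℝ (F a) x)
    (hμ : ∀ a ∈ s, pderiv i (F a) x = μ a * F a x) :
    pderiv i (fun y => ∏ a ∈ s, F a y) x = (∑ a ∈ s, μ a) * ∏ a ∈ s, F a x := by
  classical
  have := Fintype.ofFinite ι
  have hprod := (HasFDerivAt.finsetProd fun a ha => (hF a ha).hasFDerivAt).fderiv
  simp only [pderiv, hprod, sum_apply, FunLike.coe_smul, Pi.smul_apply, smul_eq_mul,
    Finset.sum_mul]
  refine Finset.sum_congr rfl fun a ha => ?_
  rw [← pderiv, hμ a ha, ← Finset.mul_prod_erase s _ ha]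
  ring

theorem pderiv_div_eq_zero_of_log {μ : ℝ} (hf : DifferentiableAt ℝ f x)
    (hh : DifferentiableAt ℝ h x) (h0 : h x ≠ 0) (hfμ : pderiv i f x = μ * f x)
    (hhμ : pderiv i h x = μ * h x) : pderiv i (fun y => f y / h y) x = 0 := by
  have := Fintype.ofFinite ι
  have hinv : pderiv i (fun y => (h y)⁻¹) x = -(h x ^ 2)⁻¹ * pderiv i h x :=
    pderiv_comp (hasDerivAt_inv h0) hh
  simp only [div_eq_mul_inv]
  rw [pderiv_mul hf (hh.fun_inv h0), hinv, hfμ, hhμ]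
  field_simp
  ring

end Finite

section Fintype

variable [Fintype ι]

theorem contDiffOn_pderiv (hU : IsOpen U) (hf : ContDiffOn ℝ ∞ f U) (i : ι) :
    ContDiffOn ℝ ∞ (pderiv i f) U :=
  (hf.fderiv_of_isOpen hU (m := ∞) (by simp)).clm_apply contDiffOn_const

theorem pderiv_comm (hf : ContDiffAt ℝ 2 f x) :
    pderiv i (pderiv j f) x = pderiv j (pderiv i f) x := by
  have hd : DifferentiableAt ℝ (fderiv ℝ f) x :=
    (hf.fderiv_right (m := 1) le_rfl).differentiableAt one_ne_zero
  have key : ∀ v w : ι → ℝ,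
      fderiv ℝ (fun y => fderiv ℝ f y v) x w = fderiv ℝ (fderiv ℝ f) x w v := by
    intro v w
    rw [fderiv_clm_apply hd (differentiableAt_const v)]
    simp
  change fderiv ℝ (fun y => fderiv ℝ f y _) x _ = fderiv ℝ (fun y => fderiv ℝ f y _) x _
  rw [key, key]
  exact (hf.isSymmSndFDerivAt (by simp)) _ _

theorem fderiv_apply_eq_sum_pderiv (v : ι → ℝ) : fderiv ℝ f x v = ∑ i, v i * pderiv i f x := by
  conv_lhs => rw [pi_eq_sum_univ' v, map_sum]
  simp only [map_smul, smul_eq_mul, pderiv]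

omit [Fintype ι] in
theorem eq_of_pderiv_eq_zero [Finite ι] {s : Set ι} [DecidablePred (· ∈ s)] (hU : IsOpen U)
    (hc : IsPreconnected U) (hs : ∀ x ∈ U, ∀ y ∈ U, s.piecewise x y ∈ U)
    (hf : ∀ x ∈ U, DifferentiableAt ℝ f x) (h0 : ∀ x ∈ U, ∀ i ∈ s, pderiv i f x = 0)
    {x y : ι → ℝ} (hx : x ∈ U) (hy : y ∈ U) (hxy : ∀ i ∉ s, x i = y i) : f x = f y := by
  have := Fintype.ofFinite ι
  let m' : (ι → ℝ) →L[ℝ] (ι → ℝ) :=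
    ContinuousLinearMap.pi fun i => if i ∈ s then ContinuousLinearMap.proj i else 0
  have hm (z : ι → ℝ) : HasFDerivAt (fun z => s.piecewise z y) m' z := by
    refine hasFDerivAt_pi'.2 fun i => ?_
    by_cases hi : i ∈ s
    · simpa [m', hi] using hasFDerivAt_apply (𝕜 := ℝ) i z
    · simpa [m', hi] using hasFDerivAt_const (y i) z
  have hd : ∀ z ∈ U, HasFDerivAt (fun z => f (s.piecewise z y))
      ((fderiv ℝ f (s.piecewise z y)).comp m') z :=
    fun z hz => (hf _ (hs z hz y hy)).hasFDerivAt.comp z (hm z)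
  have hd0 : Set.EqOn (fderiv ℝ fun z => f (s.piecewise z y)) 0 U := by
    intro z hz
    ext v
    rw [(hd z hz).fderiv, ContinuousLinearMap.comp_apply, fderiv_apply_eq_sum_pderiv]
    refine Finset.sum_eq_zero fun i _ => ?_
    by_cases hi : i ∈ s
    · rw [h0 _ (hs z hz y hy) i hi, mul_zero]
    · simp [m', hi]
  have hconst := hU.is_const_of_fderiv_eq_zero hc
    (fun z hz => (hd z hz).differentiableAt.differentiableWithinAt) hd0 hx hy
  have hxy' : s.piecewise x y = x := by
    funext i
    by_cases hi : i ∈ s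
    · exact s.piecewise_eq_of_mem x y hi
    · rw [s.piecewise_eq_of_notMem x y hi, hxy i hi]
  simpa [hxy'] using hconst

end Fintype

end PartialDerivatives

/-! ### Primitives depending on parameters -/

section Primitive

open MeasureTheory

variable {E : Type*} [NormedAddCommGroup E] [NormedSpace ℝ E]

theorem contDiff_parametric_unitIntegral {F : ℝ × E → ℝ} (hF : ContDiff ℝ ∞ F) :
    ContDiff ℝ ∞ fun q : E => ∫ u in (0 : ℝ)..1, F (u, q) := by
  -- The integral is the value at 0 of the convolution of the indicator function of `(0, 1]` with
  -- the function `u ↦ χ u * F (-u, q)`, for a bump function `χ` equal to `1` on `[-1, 1]`.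
  let χ : ContDiffBump (0 : ℝ) := ⟨1, 2, one_pos, one_lt_two⟩
  let G : E → ℝ → ℝ := fun q u => χ u * F (-u, q)
  have hG : ContDiff ℝ ∞ (Function.uncurry G) :=
    (χ.contDiff.comp contDiff_snd).mul (hF.comp (by fun_prop))
  have hGsupp : ∀ q u, u ∉ Metric.closedBall (0 : ℝ) χ.rOut → G q u = 0 := fun q u hu => by
    simp [G, χ.zero_of_le_dist (x := u) (by simpa using (not_le.1 (by simpa using hu)).le)]
  have hind : LocallyIntegrable ((Set.Ioc (0 : ℝ) 1).indicator (1 : ℝ → ℝ)) volume :=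
    ((integrable_indicator_iff measurableSet_Ioc).2
      (integrableOn_const (by simp))).locallyIntegrable
  have hconv := contDiffOn_convolution_right_with_param_comp (n := ⊤)
    (ContinuousLinearMap.mul ℝ ℝ) (v := fun _ : E => (0 : ℝ)) contDiffOn_const isOpen_univ
    (isCompact_closedBall _ _) (fun q u _ hu => hGsupp q u hu) hind hG.contDiffOn
  refine contDiffOn_univ.1 (hconv.congr fun q _ => ?_)
  rw [intervalIntegral.integral_of_le zero_le_one, convolution,
    ← integral_indicator measurableSet_Ioc]
  congr 1
  funext u
  by_cases hu : u ∈ Set.Ioc (0 : ℝ) 1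
  · have : χ (-u) = 1 := χ.one_of_mem_closedBall (by
      simpa [χ] using abs_le.2 ⟨by linarith [hu.1], hu.2⟩)
    simp [hu, G, this]
  · simp [hu]

theorem contDiff_parametric_primitive {F : ℝ × E → ℝ} (hF : ContDiff ℝ ∞ F) (t₀ : ℝ) :
    ContDiff ℝ ∞ fun q : ℝ × E => ∫ s in t₀..q.1, F (s, q.2) := by
  have hint := contDiff_parametric_unitIntegral
    (F := fun w : ℝ × (ℝ × E) => F (t₀ + w.1 * (w.2.1 - t₀), w.2.2)) (hF.comp (by fun_prop))
  have hsub : ContDiff ℝ ∞ fun q : ℝ × E => q.1 - t₀ := by fun_prop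
  suffices (fun q : ℝ × E => ∫ s in t₀..q.1, F (s, q.2)) =
      fun q => (q.1 - t₀) * ∫ u in (0 : ℝ)..1, F (t₀ + u * (q.1 - t₀), q.2) from
    this ▸ hsub.mul hint
  funext q
  simpa [mul_comm] using (intervalIntegral.smul_integral_comp_add_mul (fun s => F (s, q.2))
    (a := 0) (b := 1) (q.1 - t₀) t₀).symm

theorem exists_contDiff_eventuallyEq [FiniteDimensional ℝ E] {f : E → ℝ} {x : E}
    (hf : ∀ᶠ y in 𝓝 x, ContDiffAt ℝ ∞ f y) : ∃ F : E → ℝ, ContDiff ℝ ∞ F ∧ F =ᶠ[𝓝 x] f := by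
  obtain ⟨r, hr, hball⟩ := Metric.eventually_nhds_iff_ball.1 hf
  let χ : ContDiffBump x := ⟨r / 3, r / 2, by positivity, by linarith⟩
  refine ⟨fun y => χ y * f y, contDiff_iff_contDiffAt.2 fun y => ?_, ?_⟩
  · by_cases hy : y ∈ Metric.ball x r
    · exact χ.contDiffAt.mul (hball y hy)
    · have hy' : y ∉ tsupport χ := by
        rw [χ.tsupport_eq]
        exact fun h => hy (Metric.closedBall_subset_ball (by simp [χ, hr]) h)
      refine (contDiffAt_const (c := (0 : ℝ))).congr_of_eventuallyEq ?_
      filter_upwards [notMem_tsupport_iff_eventuallyEq.1 hy'] with z hz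
      simp [hz]
  · filter_upwards [χ.eventuallyEq_one] with y hy
    simp [hy]

end Primitive

/-! ### Curvature of orthogonal coordinates -/

/-- A smooth pseudo-Riemannian metric on the open set `U`, of any signature, through its matrix of
components. -/
structure IsMetricOn {ι : Type} [Fintype ι] [DecidableEq ι] (U : Set (ι → ℝ))
    (g : (ι → ℝ) → Matrix ι ι ℝ) : Prop where
  isOpen : IsOpen U
  smooth : ∀ i j, ContDiffOn ℝ ∞ (fun x => g x i j) U
  symm : ∀ x ∈ U, ∀ i j, g x i j = g x j i
  det_ne_zero : ∀ x ∈ U, (g x).det ≠ 0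

/-- The logarithm of the `i`-th Lamé coefficient `H_i = √|g_ii|` of orthogonal coordinates; the
absolute value is implicit in `Real.log`. -/
noncomputable def logLame {ι : Type} (g : (ι → ℝ) → Matrix ι ι ℝ) (i : ι) (x : ι → ℝ) : ℝ :=
  Real.log (g x i i) / 2

/-- The Lamé equation `∂_j ∂_k H_i = ∂_k (log H_j) ∂_j H_i + ∂_j (log H_k) ∂_k H_i` at a point,
divided by `H_i`. -/
def LameEquation {ι : Type} [DecidableEq ι] (g : (ι → ℝ) → Matrix ι ι ℝ) (i j k : ι)
    (x : ι → ℝ) : Prop :=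
  pderiv k (pderiv j (logLame g i)) x + pderiv j (logLame g i) x * pderiv k (logLame g i) x =
    pderiv j (logLame g i) x * pderiv k (logLame g j) x +
      pderiv k (logLame g i) x * pderiv j (logLame g k) x

/-- The Lamé equations on `U`: for orthogonal coordinates, they express diagonal curvature. -/
def SatisfiesLame {ι : Type} [DecidableEq ι] (U : Set (ι → ℝ)) (g : (ι → ℝ) → Matrix ι ι ℝ) :
    Prop :=
  ∀ x ∈ U, ∀ i j k, i ≠ j → i ≠ k → j ≠ k → LameEquation g i j k x

section Metric

variable {ι : Type} [Fintype ι] [DecidableEq ι] {U : Set (ι → ℝ)} {g : (ι → ℝ) → Matrix ι ι ℝ}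
  {x : ι → ℝ}

theorem IsMetricOn.mono (hg : IsMetricOn U g) {V : Set (ι → ℝ)} (hV : IsOpen V) (hVU : V ⊆ U) :
    IsMetricOn V g :=
  ⟨hV, fun i j => (hg.smooth i j).mono hVU, fun x hx => hg.symm x (hVU hx),
    fun x hx => hg.det_ne_zero x (hVU hx)⟩

theorem IsMetricOn.contDiffAt (hg : IsMetricOn U g) (hx : x ∈ U) (i j : ι) :
    ContDiffAt ℝ ∞ (fun y => g y i j) x :=
  (hg.smooth i j).contDiffAt (hg.isOpen.mem_nhds hx)

theorem IsMetricOn.differentiableAt (hg : IsMetricOn U g) (hx : x ∈ U) (i j : ι) :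
    DifferentiableAt ℝ (fun y => g y i j) x :=
  (hg.contDiffAt hx i j).differentiableAt (by simp)

theorem IsMetricOn.christoffel_comm (hg : IsMetricOn U g) (hx : x ∈ U) (m i j : ι) :
    christoffel g m i j x = christoffel g m j i x := by
  have hsymm (l : ι) : pderiv l (fun y => g y i j) x = pderiv l (fun y => g y j i) x :=
    pderiv_congr_of_eqOn hg.isOpen (fun y hy => hg.symm y hy i j) hx
  simp only [christoffel, hsymm, add_comm (pderiv i _ x)]

namespace IsOrthogonal

omit [Fintype ι] in
theorem eq_diagonal (ho : IsOrthogonal U g) (hx : x ∈ U) :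
    g x = Matrix.diagonal fun i => g x i i :=
  (Matrix.IsDiag.diagonal_diag (ho x hx)).symm

theorem diag_ne_zero (ho : IsOrthogonal U g) (hg : IsMetricOn U g) (hx : x ∈ U) (i : ι) :
    g x i i ≠ 0 := by
  have hdet := hg.det_ne_zero x hx
  rw [ho.eq_diagonal hx, Matrix.det_diagonal] at hdet
  exact Finset.prod_ne_zero_iff.1 hdet i (Finset.mem_univ i)

theorem inv_eq_diagonal (ho : IsOrthogonal U g) (hg : IsMetricOn U g) (hx : x ∈ U) :
    (g x)⁻¹ = Matrix.diagonal fun i => (g x i i)⁻¹ := by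
  refine Matrix.inv_eq_right_inv ?_
  nth_rw 1 [ho.eq_diagonal hx]
  simp [ho.diag_ne_zero hg hx]

omit [Fintype ι] in
theorem pderiv_offDiag (ho : IsOrthogonal U g) (hU : IsOpen U) (hx : x ∈ U) {i j : ι}
    (hij : i ≠ j) (k : ι) : pderiv k (fun y => g y i j) x = 0 :=
  pderiv_eq_zero_of_eqOn_const hU (fun y hy => ho y hy i j hij) hx

theorem pderiv_logLame (ho : IsOrthogonal U g) (hg : IsMetricOn U g) (hx : x ∈ U) (i j : ι) :
    pderiv j (logLame g i) x = pderiv j (fun y => g y i i) x / (2 * g x i i) := by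
  refine (pderiv_comp (F := fun t => Real.log t / 2)
    ((Real.hasDerivAt_log (ho.diag_ne_zero hg hx i)).div_const 2)
    (hg.differentiableAt hx i i)).trans ?_
  field_simp

theorem contDiffOn_logLame (ho : IsOrthogonal U g) (hg : IsMetricOn U g) (i : ι) :
    ContDiffOn ℝ ∞ (logLame g i) U :=
  ((hg.smooth i i).log fun _ hx => ho.diag_ne_zero hg hx i).div_const 2

theorem pderiv_logLame_comm (ho : IsOrthogonal U g) (hg : IsMetricOn U g) (hx : x ∈ U)
    (i j k : ι) : pderiv j (pderiv k (logLame g i)) x = pderiv k (pderiv j (logLame g i)) x :=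
  pderiv_comm (((ho.contDiffOn_logLame hg i).contDiffAt (hg.isOpen.mem_nhds hx)).of_le
    (WithTop.coe_le_coe.2 le_top))

theorem lameEquation_comm (ho : IsOrthogonal U g) (hg : IsMetricOn U g) (hx : x ∈ U) {i j k : ι} :
    LameEquation g i j k x ↔ LameEquation g i k j x := by
  rw [LameEquation, LameEquation, ho.pderiv_logLame_comm hg hx, mul_comm (pderiv j (logLame g i) x),
    add_comm (_ * pderiv k (logLame g j) x)]

theorem christoffel_eq (ho : IsOrthogonal U g) (hg : IsMetricOn U g) (hx : x ∈ U) (m i j : ι) :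
    christoffel g m i j x = (pderiv i (fun y => g y m j) x + pderiv j (fun y => g y m i) x
      - pderiv m (fun y => g y i j) x) / (2 * g x m m) := by
  simp only [christoffel, ho.inv_eq_diagonal hg hx, Matrix.diagonal_apply, ite_mul, zero_mul,
    Finset.sum_ite_eq, Finset.mem_univ, if_true]
  ring

theorem christoffel_of_ne (ho : IsOrthogonal U g) (hg : IsMetricOn U g) (hx : x ∈ U) {m i j : ι}
    (hmi : m ≠ i) (hmj : m ≠ j) (hij : i ≠ j) : christoffel g m i j x = 0 := by
  simp [ho.christoffel_eq hg hx, ho.pderiv_offDiag hg.isOpen hx, hmi, hmj, hij]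

theorem christoffel_self_left (ho : IsOrthogonal U g) (hg : IsMetricOn U g) (hx : x ∈ U)
    (i j : ι) : christoffel g i i j x = pderiv j (logLame g i) x := by
  rw [ho.christoffel_eq hg hx, ho.pderiv_logLame hg hx, add_sub_cancel_left]

theorem christoffel_self_right (ho : IsOrthogonal U g) (hg : IsMetricOn U g) (hx : x ∈ U)
    (i j : ι) : christoffel g i j i x = pderiv j (logLame g i) x := by
  rw [hg.christoffel_comm hx, ho.christoffel_self_left hg hx]

theorem christoffel_diag (ho : IsOrthogonal U g) (hg : IsMetricOn U g) (hx : x ∈ U) {i k : ι}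
    (hik : i ≠ k) :
    christoffel g i k k x = -(g x k k / g x i i * pderiv i (logLame g k) x) := by
  have hi := ho.diag_ne_zero hg hx i
  have hk := ho.diag_ne_zero hg hx k
  rw [ho.christoffel_eq hg hx, ho.pderiv_offDiag hg.isOpen hx hik, ho.pderiv_logLame hg hx]
  field_simp
  ring

theorem riemann_eq (ho : IsOrthogonal U g) (hx : x ∈ U) (i j k l : ι) :
    riemann g i j k l x = g x i i *
      (pderiv k (christoffel g i l j) x - pderiv l (christoffel g i k j) x
        + ∑ r, (christoffel g i k r x * christoffel g r l j x
          - christoffel g i l r x * christoffel g r k j x)) :=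
  Finset.sum_eq_single i (fun m _ hm => by rw [ho x hx i m hm.symm, zero_mul]) (by simp)

theorem riemann_self_self (ho : IsOrthogonal U g) (hg : IsMetricOn U g) (hx : x ∈ U) {i k : ι}
    (hik : i ≠ k) : riemann g i i i k x = 0 := by
  have hi := ho.diag_ne_zero hg hx i
  have hk := ho.diag_ne_zero hg hx k
  have hderiv : pderiv i (christoffel g i k i) x = pderiv k (christoffel g i i i) x := by
    rw [pderiv_congr_of_eqOn hg.isOpen (fun y hy => ho.christoffel_self_right hg hy i k) hx,
      pderiv_congr_of_eqOn hg.isOpen (fun y hy => ho.christoffel_self_left hg hy i i) hx]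
    exact ho.pderiv_logLame_comm hg hx i i k
  rw [ho.riemann_eq hx, hderiv, ← Finset.sum_subset (Finset.subset_univ {i, k}),
    Finset.sum_pair hik]
  · rw [ho.christoffel_self_left hg hx, ho.christoffel_self_left hg hx,
      ho.christoffel_self_left hg hx, ho.christoffel_self_right hg hx,
      ho.christoffel_diag hg hx hik, ho.christoffel_diag hg hx hik.symm]
    field_simp
    ring
  · intro r _ hr
    simp only [Finset.mem_insert, Finset.mem_singleton, not_or] at hr
    rw [ho.christoffel_of_ne hg hx hr.2 hr.1 hik.symm,
      ho.christoffel_of_ne hg hx hik (Ne.symm hr.1) (Ne.symm hr.2)]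
    ring

theorem riemann_of_ne (ho : IsOrthogonal U g) (hg : IsMetricOn U g) (hx : x ∈ U) {i j k : ι}
    (hij : i ≠ j) (hik : i ≠ k) (hjk : j ≠ k) (hlame : LameEquation g i j k x) :
    riemann g i j i k x = 0 := by
  rw [ho.riemann_eq hx,
    pderiv_eq_zero_of_eqOn_const hg.isOpen
      (fun y hy => ho.christoffel_of_ne hg hy hik hij hjk.symm) hx,
    pderiv_congr_of_eqOn hg.isOpen (fun y hy => ho.christoffel_self_left hg hy i j) hx,
    ← Finset.sum_subset (Finset.subset_univ {i, j, k}),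
    Finset.sum_insert (by simp [hij, hik]), Finset.sum_pair hjk]
  · rw [ho.christoffel_of_ne hg hx hik hij hjk.symm,
      ho.christoffel_of_ne hg hx hik.symm hjk.symm hij, ho.christoffel_self_left hg hx i j,
      ho.christoffel_self_left hg hx i k, ho.christoffel_self_left hg hx k j,
      ho.christoffel_self_right hg hx j k, ho.christoffel_self_right hg hx i k]
    rw [LameEquation] at hlame
    linear_combination -g x i i * hlame
  · intro r _ hr
    simp only [Finset.mem_insert, Finset.mem_singleton, not_or] at hr
    rw [ho.christoffel_of_ne hg hx hr.2.2 hr.2.1 hjk.symm,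
      ho.christoffel_of_ne hg hx hik (Ne.symm hr.1) (Ne.symm hr.2.2)]
    ring

theorem isDiagonalCurvature (ho : IsOrthogonal U g) (hg : IsMetricOn U g)
    (hlame : SatisfiesLame U g) : IsDiagonalCurvature U g := by
  intro x hx i j k hjk
  rcases eq_or_ne i k with rfl | hik
  · simp [riemann]
  rcases eq_or_ne i j with rfl | hij
  · exact ho.riemann_self_self hg hx hik
  · exact ho.riemann_of_ne hg hx hij hik hjk (hlame x hx i j k hij hik hjk)

end IsOrthogonal

end Metric

/-! ### Concircular tensors in coordinates that diagonalize them -/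

/-- The coordinates on `U` diagonalize the concircular tensor `L`, with eigenvalues `lam`; `α` is
the covector field in the equation `∇_k L_{ij} = α_{(i} g_{j)k}`. -/
structure IsDiagonalConcircular {ι : Type} [Fintype ι] [DecidableEq ι] (U : Set (ι → ℝ))
    (g L : (ι → ℝ) → Matrix ι ι ℝ) (lam α : (ι → ℝ) → ι → ℝ) : Prop where
  metric : IsMetricOn U g
  smooth : ∀ i j, ContDiffOn ℝ ∞ (fun x => L x i j) U
  symm : ∀ x ∈ U, (L x).IsSymm
  mixed_eq : ∀ x ∈ U, mixed g L x = Matrix.diagonal (lam x)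
  covDeriv_eq : ∀ x ∈ U, ∀ i j k,
    covDeriv g (lower g L) k i j x = (1 / 2) * (α x i * g x j k + α x j * g x i k)

section Concircular

variable {ι : Type} [Fintype ι] [DecidableEq ι] {U : Set (ι → ℝ)} {g L : (ι → ℝ) → Matrix ι ι ℝ}
  {lam α : (ι → ℝ) → ι → ℝ} {x : ι → ℝ}

open Matrix in
theorem IsMetricOn.sum_christoffel_mul (hg : IsMetricOn U g) (hx : x ∈ U) (i j k : ι) :
    ∑ m, christoffel g m k i x * g x m j = (1 / 2) * (pderiv k (fun y => g y j i) x
      + pderiv i (fun y => g y j k) x - pderiv j (fun y => g y k i) x) := by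
  set X : ι → ℝ := fun l => pderiv k (fun y => g y l i) x + pderiv i (fun y => g y l k) x
    - pderiv l (fun y => g y k i) x
  have hΓ (m : ι) : christoffel g m k i x = (1 / 2) * ((g x)⁻¹ *ᵥ X) m := rfl
  calc ∑ m, christoffel g m k i x * g x m j
      = (1 / 2) * (g x *ᵥ (g x)⁻¹ *ᵥ X) j := by
        rw [mulVec, dotProduct, Finset.mul_sum]
        refine Finset.sum_congr rfl fun m _ => ?_
        rw [hΓ, hg.symm x hx m j]
        ring
    _ = (1 / 2) * X j := by
        rw [mulVec_mulVec, mul_nonsing_inv _ (hg.det_ne_zero x hx).isUnit, one_mulVec]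

theorem IsMetricOn.pderiv_symm (hg : IsMetricOn U g) (hx : x ∈ U) (i j k : ι) :
    pderiv k (fun y => g y i j) x = pderiv k (fun y => g y j i) x :=
  pderiv_congr_of_eqOn hg.isOpen (fun y hy => hg.symm y hy i j) hx

theorem IsMetricOn.exists_apply_ne_zero (hg : IsMetricOn U g) (hx : x ∈ U) (i : ι) :
    ∃ j, g x i j ≠ 0 := by
  by_contra! h
  exact hg.det_ne_zero x hx (Matrix.det_eq_zero_of_row_eq_zero i h)

namespace IsDiagonalConcircular

theorem contDiffOn_eigenvalue (h : IsDiagonalConcircular U g L lam α) (i : ι) :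
    ContDiffOn ℝ ∞ (fun x => lam x i) U := by
  have hsum : ContDiffOn ℝ ∞ (fun x => ∑ p, L x i p * g x p i) U :=
    ContDiffOn.sum fun p _ => (h.smooth i p).mul (h.metric.smooth p i)
  refine hsum.congr fun x hx => ?_
  rw [← Matrix.mul_apply, ← mixed, h.mixed_eq x hx, Matrix.diagonal_apply_eq]

theorem differentiableAt_eigenvalue (h : IsDiagonalConcircular U g L lam α) (hx : x ∈ U) (i : ι) :
    DifferentiableAt ℝ (fun x => lam x i) x :=
  ((h.contDiffOn_eigenvalue i).contDiffAt (h.metric.isOpen.mem_nhds hx)).differentiableAt (by simp)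

theorem lower_apply (h : IsDiagonalConcircular U g L lam α) (hx : x ∈ U) (i j : ι) :
    lower g L x i j = g x i j * lam x j := by
  rw [lower, Matrix.mul_assoc, ← mixed, h.mixed_eq x hx, Matrix.mul_diagonal]

theorem lower_symm (h : IsDiagonalConcircular U g L lam α) (hx : x ∈ U) (i j : ι) :
    lower g L x i j = lower g L x j i := by
  have hgs : (g x).IsSymm := Matrix.IsSymm.ext fun i j => h.metric.symm x hx j i
  have : (lower g L x).IsSymm := by
    rw [Matrix.IsSymm, lower, Matrix.transpose_mul, Matrix.transpose_mul, hgs, h.symm x hx,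
      Matrix.mul_assoc]
  exact this.apply j i

theorem metric_eq_zero (h : IsDiagonalConcircular U g L lam α) (hx : x ∈ U) {i j : ι}
    (hij : lam x i ≠ lam x j) : g x i j = 0 := by
  have hsymm := h.lower_symm hx i j
  rw [h.lower_apply hx, h.lower_apply hx, h.metric.symm x hx j i] at hsymm
  by_contra h0
  exact hij (mul_left_cancel₀ h0 hsymm).symm

theorem covDeriv_lower (h : IsDiagonalConcircular U g L lam α) (hx : x ∈ U) (i j k : ι) :
    covDeriv g (lower g L) k i j x
      = pderiv k (fun y => g y i j) x * lam x j + g x i j * pderiv k (fun y => lam y j) x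
        - lam x j * ((1 / 2) * (pderiv k (fun y => g y j i) x
          + pderiv i (fun y => g y j k) x - pderiv j (fun y => g y k i) x))
        - lam x i * ((1 / 2) * (pderiv k (fun y => g y i j) x
          + pderiv j (fun y => g y i k) x - pderiv i (fun y => g y k j) x)) := by
  rw [covDeriv, pderiv_congr_of_eqOn h.metric.isOpen (fun y hy => h.lower_apply hy i j) hx,
    pderiv_mul (h.metric.differentiableAt hx i j) (h.differentiableAt_eigenvalue hx j),
    ← h.metric.sum_christoffel_mul hx i j k, ← h.metric.sum_christoffel_mul hx j i k,
    Finset.mul_sum, Finset.mul_sum]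
  congr 2
  · refine Finset.sum_congr rfl fun m _ => ?_
    rw [h.lower_apply hx]
    ring
  · refine funext fun m => ?_
    rw [h.lower_symm hx, h.lower_apply hx]
    ring

theorem diag_mul_pderiv_eigenvalue (h : IsDiagonalConcircular U g L lam α) (hx : x ∈ U)
    (i k : ι) : g x i i * pderiv k (fun y => lam y i) x = α x i * g x i k := by
  have heq := h.covDeriv_eq x hx i i k
  rw [h.covDeriv_lower hx, h.metric.pderiv_symm hx i k] at heq
  linear_combination heq

theorem alpha_eq_zero (h : IsDiagonalConcircular U g L lam α) (hx : x ∈ U) {i : ι}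
    (hi : ∀ k, pderiv k (fun y => lam y i) x = 0) : α x i = 0 := by
  obtain ⟨j, hj⟩ := h.metric.exists_apply_ne_zero hx i
  have heq := h.diag_mul_pderiv_eigenvalue hx i j
  rw [hi, mul_zero] at heq
  exact (mul_eq_zero.1 heq.symm).resolve_right hj

theorem pderiv_simple_eigenvalue (h : IsDiagonalConcircular U g L lam α) (hx : x ∈ U) {i : ι}
    (hi : ∀ j ≠ i, lam x i ≠ lam x j) (k : ι) :
    pderiv k (fun y => lam y i) x = if i = k then α x i else 0 := by
  have hrow (j : ι) (hji : j ≠ i) : g x i j = 0 := h.metric_eq_zero hx (hi j hji)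
  obtain ⟨j, hj⟩ := h.metric.exists_apply_ne_zero hx i
  obtain rfl : j = i := not_imp_comm.1 (hrow j) hj
  refine mul_left_cancel₀ hj ((h.diag_mul_pderiv_eigenvalue hx j k).trans ?_)
  split_ifs with hk
  · rw [← hk, mul_comm]
  · rw [hrow k (Ne.symm hk), mul_zero, mul_zero]

theorem sub_mul_pderiv_metric (h : IsDiagonalConcircular U g L lam α) (hx : x ∈ U) {i j k : ι}
    (hij : ∀ y ∈ U, lam y i ≠ lam y j) (hjk : ∀ y ∈ U, lam y j = lam y k) :
    (lam x i - lam x j) * pderiv i (fun y => g y j k) x = α x i * g x j k := by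
  have hgij : ∀ y ∈ U, g y i j = 0 := fun y hy => h.metric_eq_zero hy (hij y hy)
  have hgik : ∀ y ∈ U, g y i k = 0 := fun y hy => h.metric_eq_zero hy (hjk y hy ▸ hij y hy)
  have heq := h.covDeriv_eq x hx i j k
  rw [h.covDeriv_lower hx, h.metric.pderiv_symm hx j i, h.metric.pderiv_symm hx k i,
    h.metric.pderiv_symm hx k j, pderiv_eq_zero_of_eqOn_const h.metric.isOpen hgij hx,
    pderiv_eq_zero_of_eqOn_const h.metric.isOpen hgik hx, hgij x hx, hgik x hx] at heq
  linear_combination 2 * heq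

end IsDiagonalConcircular

end Concircular

/-! ### Coordinates adapted to a concircular tensor -/

/-- The coordinate fields `∂_i` and `∂_j` lie in the same eigenspace of a tensor with associated
product coordinates grouped by `b`. -/
def SameEigenspace {ι : Type} {k : ℕ} (b : ι → Fin (k + 1)) (i j : ι) : Prop :=
  i = j ∨ (b i = b j ∧ b i ≠ 0)

/-- What a concircular tensor, with eigenvalues `lam` and covector field `α`, says about the metric
in its associated product coordinates. -/
structure IsAdapted {ι : Type} [Fintype ι] [DecidableEq ι] (U : Set (ι → ℝ))
    (g : (ι → ℝ) → Matrix ι ι ℝ) {k : ℕ} (b : ι → Fin (k + 1)) (lam α : (ι → ℝ) → ι → ℝ)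
    (e : Fin (k + 1) → ℝ) : Prop where
  metric : IsMetricOn U g
  connected : IsPreconnected U
  product : ∀ x : ι → ℝ, (∀ I, ∃ y ∈ U, ∀ j, b j = I → y j = x j) → x ∈ U
  factor_nonempty : ∀ I, I ≠ 0 → ∃ i, b i = I
  lam_smooth : ∀ i, ContDiffOn ℝ ∞ (fun x => lam x i) U
  lam_eq_iff : ∀ x ∈ U, ∀ i j, lam x i = lam x j ↔ SameEigenspace b i j
  lam_const : ∀ x ∈ U, ∀ i, b i ≠ 0 → lam x i = e (b i)
  alpha_eq_zero : ∀ x ∈ U, ∀ i, b i ≠ 0 → α x i = 0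
  pderiv_lam : ∀ x ∈ U, ∀ i k, pderiv k (fun y => lam y i) x = if i = k then α x i else 0
  metric_eq_zero : ∀ x ∈ U, ∀ i j, ¬ SameEigenspace b i j → g x i j = 0
  pderiv_metric : ∀ x ∈ U, ∀ i j k, SameEigenspace b j k → ¬ SameEigenspace b i j →
    (lam x i - lam x j) * pderiv i (fun y => g y j k) x = α x i * g x j k

section SameEigenspace

variable {ι : Type} {k : ℕ} {b : ι → Fin (k + 1)} {i j l : ι}

theorem SameEigenspace.symm (h : SameEigenspace b i j) : SameEigenspace b j i := by
  rcases h with rfl | ⟨h, h'⟩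
  · exact .inl rfl
  · exact .inr ⟨h.symm, h ▸ h'⟩

theorem SameEigenspace.trans (h : SameEigenspace b i j) (h' : SameEigenspace b j l) :
    SameEigenspace b i l := by
  rcases h with rfl | ⟨hij, hi⟩
  · exact h'
  · rcases h' with rfl | ⟨hjl, -⟩
    · exact .inr ⟨hij, hi⟩
    · exact .inr ⟨hij.trans hjl, hi⟩

theorem SameEigenspace.ne_zero (h : SameEigenspace b i j) (hij : i ≠ j) : b i ≠ 0 :=
  (h.resolve_left hij).2

end SameEigenspace

section Structure

variable {ι : Type} [Fintype ι] [DecidableEq ι] {U : Set (ι → ℝ)} {g L : (ι → ℝ) → Matrix ι ι ℝ}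
  {k : ℕ} {b : ι → Fin (k + 1)}

theorem IsConcircular.exists_isAdapted (hL : IsConcircular U g L) (hg : IsMetricOn U g)
    (hb : IsAssociatedProduct U g L b) : ∃ lam α e, IsAdapted U g b lam α e := by
  obtain ⟨lam, e, heigen⟩ := hb.eigen
  obtain ⟨α, hα⟩ := hL.eqn
  have hdiag : IsDiagonalConcircular U g L lam α :=
    ⟨hg, hL.smooth, hL.symm, fun x hx => (heigen x hx).1, hα⟩
  have hsame : ∀ x ∈ U, ∀ i j, lam x i = lam x j ↔ SameEigenspace b i j :=
    fun x hx i j => (heigen x hx).2.2 i j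
  have hconst : ∀ x ∈ U, ∀ i, b i ≠ 0 → lam x i = e (b i) := fun x hx => (heigen x hx).2.1
  have hlam0 : ∀ x ∈ U, ∀ i, b i ≠ 0 → ∀ k, pderiv k (fun y => lam y i) x = 0 :=
    fun x hx i hi k => pderiv_eq_zero_of_eqOn_const hg.isOpen (fun y hy => hconst y hy i hi) hx
  have hα0 : ∀ x ∈ U, ∀ i, b i ≠ 0 → α x i = 0 := fun x hx i hi =>
    hdiag.alpha_eq_zero hx (hlam0 x hx i hi)
  have hne : ∀ I, I ≠ 0 → ∃ i, b i = I := fun I hI => by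
    obtain ⟨i⟩ := Fintype.card_pos_iff.1 (zero_lt_one.trans (hb.dim I hI))
    exact ⟨i, i.2⟩
  refine ⟨lam, α, e, hg, hb.connected.isPreconnected, hb.product, hne,
    hdiag.contDiffOn_eigenvalue, hsame, hconst, hα0, fun x hx i k => ?_,
    fun x hx i j hij => hdiag.metric_eq_zero hx (mt (hsame x hx i j).1 hij),
    fun x hx i j k hjk hij => hdiag.sub_mul_pderiv_metric hx
      (fun y hy => mt (hsame y hy i j).1 hij) fun y hy => (hsame y hy j k).2 hjk⟩
  by_cases hi : b i = 0
  · exact hdiag.pderiv_simple_eigenvalue hx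
      (fun j hj h => ((hsame x hx i j).1 h).ne_zero hj.symm hi) k
  · rw [hlam0 x hx i hi, hα0 x hx i hi, ite_self]

end Structure

/-! ### Leaves -/

/-- The coordinates of `x` in the `I`-th factor. -/
def restrictTo {ι : Type} {k : ℕ} (b : ι → Fin (k + 1)) (I : Fin (k + 1)) (x : ι → ℝ) :
    {j // b j = I} → ℝ :=
  fun j => x j

section Leaves

variable {ι : Type} {k : ℕ} {b : ι → Fin (k + 1)} {I : Fin (k + 1)} {x p : ι → ℝ}

theorem contDiff_restrictTo [Fintype ι] : ContDiff ℝ ∞ (restrictTo b I) :=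
  contDiff_pi.2 fun j => contDiff_apply ℝ ℝ j.1

theorem contDiff_leafPoint [Fintype ι] (p : ι → ℝ) : ContDiff ℝ ∞ (leafPoint b I p) := by
  refine contDiff_pi.2 fun j => ?_
  by_cases h : b j = I
  · simpa only [leafPoint, h, dite_true] using contDiff_apply ℝ ℝ (⟨j, h⟩ : {j // b j = I})
  · simpa only [leafPoint, h, dite_false] using contDiff_const

theorem leafPoint_restrictTo [∀ j, Decidable (j ∈ b ⁻¹' {I})] :
    leafPoint b I p (restrictTo b I x) = (b ⁻¹' {I}).piecewise x p := by
  funext j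
  by_cases h : b j = I <;> simp [leafPoint, restrictTo, h]

theorem pderiv_comp_restrictTo [Finite ι] [DecidableEq ι] {h : ({j // b j = I} → ℝ) → ℝ}
    (hh : DifferentiableAt ℝ h (restrictTo b I x)) (i : ι) :
    pderiv i (fun z => h (restrictTo b I z)) x =
      if hi : b i = I then pderiv ⟨i, hi⟩ h (restrictTo b I x) else 0 := by
  have := Fintype.ofFinite ι
  let ℓ : (ι → ℝ) →L[ℝ] ({j // b j = I} → ℝ) :=
    ContinuousLinearMap.pi fun j => ContinuousLinearMap.proj j.1
  have hℓ : HasFDerivAt (restrictTo b I) ℓ x := ℓ.hasFDerivAt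
  have hcomp : pderiv i (fun z => h (restrictTo b I z)) x =
      fderiv ℝ h (restrictTo b I x) (restrictTo b I (Pi.single i 1)) :=
    congrArg (fun T => T (Pi.single i 1)) (hh.hasFDerivAt.comp x hℓ).fderiv
  rw [hcomp]
  split_ifs with hi
  · congr 1
    funext j
    simp [restrictTo, Pi.single_apply, Subtype.ext_iff]
  · have hzero : restrictTo b I (Pi.single i 1) = 0 :=
      funext fun j => Pi.single_eq_of_ne (fun hji : j.1 = i => hi (hji ▸ j.2)) 1
    rw [hzero, map_zero]

end Leaves

namespace IsAdapted

variable {ι : Type} [Fintype ι] [DecidableEq ι] {U : Set (ι → ℝ)} {g : (ι → ℝ) → Matrix ι ι ℝ}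
  {k : ℕ} {b : ι → Fin (k + 1)} {lam α : (ι → ℝ) → ι → ℝ} {e : Fin (k + 1) → ℝ}
  {I : Fin (k + 1)} {x p : ι → ℝ} {i j l : ι}

theorem piecewise_mem (ha : IsAdapted U g b lam α e) (s : Set (Fin (k + 1)))
    [∀ j, Decidable (j ∈ b ⁻¹' s)] (hx : x ∈ U) (hp : p ∈ U) : (b ⁻¹' s).piecewise x p ∈ U := by
  refine ha.product _ fun I => ?_
  by_cases hI : I ∈ s
  · exact ⟨x, hx, fun j hj => by simp [hj, hI]⟩
  · exact ⟨p, hp, fun j hj => by simp [hj, hI]⟩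

theorem leafPoint_mem (ha : IsAdapted U g b lam α e) (hp : p ∈ U) (hx : x ∈ U) :
    leafPoint b I p (restrictTo b I x) ∈ U := by
  classical
  rw [leafPoint_restrictTo]
  exact ha.piecewise_mem {I} hx hp

theorem metric_blockTriangular (ha : IsAdapted U g b lam α e) (hx : x ∈ U) :
    (g x).BlockTriangular b := fun i j hji => ha.metric_eq_zero x hx i j (by
  rintro (rfl | ⟨h, -⟩)
  exacts [hji.false, hji.ne h.symm])

theorem isMetricOn_leafMetric (ha : IsAdapted U g b lam α e) :
    IsMetricOn (leafDomain b I p U) (leafMetric b I p g) where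
  isOpen := ha.metric.isOpen.preimage (contDiff_leafPoint p).continuous
  smooth i j := (ha.metric.smooth i.1 j.1).comp (contDiff_leafPoint p).contDiffOn fun _ hy => hy
  symm _ hy i j := ha.metric.symm _ hy i.1 j.1
  det_ne_zero y hy := by
    have hdet := ha.metric.det_ne_zero _ hy
    rw [(ha.metric_blockTriangular hy).det_fintype] at hdet
    exact Finset.prod_ne_zero_iff.1 hdet I (Finset.mem_univ I)

theorem differentiableAt_lam (ha : IsAdapted U g b lam α e) (hx : x ∈ U) (i : ι) :
    DifferentiableAt ℝ (fun y => lam y i) x :=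
  ((ha.lam_smooth i).contDiffAt (ha.metric.isOpen.mem_nhds hx)).differentiableAt (by simp)

theorem lam_sub_ne_zero (ha : IsAdapted U g b lam α e) (hx : x ∈ U)
    (h : ¬ SameEigenspace b i j) : lam x i - lam x j ≠ 0 :=
  sub_ne_zero.2 (mt (ha.lam_eq_iff x hx i j).1 h)

theorem sub_lam_ne_zero (ha : IsAdapted U g b lam α e) (hx : x ∈ U) (hI : I ≠ 0) (hi : b i = 0) :
    e I - lam x i ≠ 0 := by
  obtain ⟨j, rfl⟩ := ha.factor_nonempty I hI
  rw [← ha.lam_const x hx j hI]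
  refine ha.lam_sub_ne_zero hx ?_
  rintro (rfl | ⟨h, -⟩)
  exacts [hI hi, hI (h.trans hi)]

theorem pderiv_metric_of_not_sameEigenspace (ha : IsAdapted U g b lam α e) (hx : x ∈ U)
    (hjl : SameEigenspace b j l) (hij : ¬ SameEigenspace b i j) :
    pderiv i (fun y => g y j l) x = α x i / (lam x i - lam x j) * g x j l := by
  rw [div_mul_eq_mul_div, eq_div_iff (ha.lam_sub_ne_zero hx hij), mul_comm]
  exact ha.pderiv_metric x hx i j l hjl hij

theorem pderiv_prod_sub_lam (ha : IsAdapted U g b lam α e) (hx : x ∈ U) {s : Finset ι}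
    {f : (ι → ℝ) → ℝ} (hf : DifferentiableAt ℝ f x) (hfi : pderiv i f x = 0)
    (hs : ∀ r ∈ s, f x - lam x r ≠ 0) :
    pderiv i (fun y => ∏ r ∈ s, (f y - lam y r)) x =
      (if i ∈ s then α x i / (lam x i - f x) else 0) * ∏ r ∈ s, (f x - lam x r) := by
  rw [pderiv_prod_of_log (μ := fun r => if r = i then α x i / (lam x i - f x) else 0)
    (fun r _ => hf.fun_sub (ha.differentiableAt_lam hx r)) fun r hr => ?_, Finset.sum_ite_eq']
  rw [pderiv_sub hf (ha.differentiableAt_lam hx r), hfi, ha.pderiv_lam x hx]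
  split_ifs with hri
  · subst hri
    have hr0 : lam x r - f x ≠ 0 := fun h => hs r hr (by rw [← neg_sub, h, neg_zero])
    rw [div_mul_eq_mul_div, eq_div_iff hr0]
    ring
  · ring

end IsAdapted

/-! ### Warping functions -/

/-- The indices of the coordinates on `M_0`, that is of the simple eigenvalues. -/
def simpleIndices {ι : Type} [Fintype ι] {k : ℕ} (b : ι → Fin (k + 1)) : Finset ι :=
  {a | b a = 0}

theorem mem_simpleIndices {ι : Type} [Fintype ι] {k : ℕ} {b : ι → Fin (k + 1)} {a : ι} :
    a ∈ simpleIndices b ↔ b a = 0 := by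
  simp [simpleIndices]

/-- The function `∏ (c - λ_a)`, the product over the simple eigenvalues; for `c = e I` it is, up to
a constant factor, the function by which the metric of the `I`-th factor is warped. -/
def warpingFunction {ι : Type} [Fintype ι] {k : ℕ} (b : ι → Fin (k + 1))
    (lam : (ι → ℝ) → ι → ℝ) (c : ℝ) (x : ι → ℝ) : ℝ :=
  ∏ a ∈ simpleIndices b, (c - lam x a)

namespace IsAdapted

variable {ι : Type} [Fintype ι] [DecidableEq ι] {U : Set (ι → ℝ)} {g : (ι → ℝ) → Matrix ι ι ℝ}
  {k : ℕ} {b : ι → Fin (k + 1)} {lam α : (ι → ℝ) → ι → ℝ} {e : Fin (k + 1) → ℝ}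
  {I : Fin (k + 1)} {x p : ι → ℝ} {i j l : ι}

theorem warpingFunction_ne_zero (ha : IsAdapted U g b lam α e) (hx : x ∈ U) (hI : I ≠ 0) :
    warpingFunction b lam (e I) x ≠ 0 :=
  Finset.prod_ne_zero_iff.2 fun _ h => ha.sub_lam_ne_zero hx hI (mem_simpleIndices.1 h)

theorem differentiableAt_warpingFunction (ha : IsAdapted U g b lam α e) (hx : x ∈ U) (c : ℝ) :
    DifferentiableAt ℝ (warpingFunction b lam c) x := by
  have hlam := ha.differentiableAt_lam hx
  unfold warpingFunction
  fun_prop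

theorem pderiv_warpingFunction (ha : IsAdapted U g b lam α e) (hx : x ∈ U) (hI : I ≠ 0) (i : ι) :
    pderiv i (warpingFunction b lam (e I)) x =
      α x i / (lam x i - e I) * warpingFunction b lam (e I) x := by
  refine (ha.pderiv_prod_sub_lam hx (differentiableAt_const (e I)) (pderiv_const _)
    fun a h => ha.sub_lam_ne_zero hx hI (mem_simpleIndices.1 h)).trans ?_
  by_cases hi : b i = 0
  · simp [warpingFunction, mem_simpleIndices, hi]
  · simp [ha.alpha_eq_zero x hx i hi]

theorem pderiv_warpingFunction_eq_zero (ha : IsAdapted U g b lam α e) (hx : x ∈ U) (hI : I ≠ 0)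
    (hi : b i ≠ 0) : pderiv i (warpingFunction b lam (e I)) x = 0 := by
  rw [ha.pderiv_warpingFunction hx hI, ha.alpha_eq_zero x hx i hi, zero_div, zero_mul]

theorem warpingFunction_leafPoint (ha : IsAdapted U g b lam α e) (hx : x ∈ U) (hp : p ∈ U)
    (hI : I ≠ 0) : warpingFunction b lam (e I) (leafPoint b I p (restrictTo b I x)) =
      warpingFunction b lam (e I) p := by
  classical
  rw [leafPoint_restrictTo]
  refine eq_of_pderiv_eq_zero (s := b ⁻¹' {I}) ha.metric.isOpen ha.connected
    (fun x hx y hy => ha.piecewise_mem {I} hx hy)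
    (fun y hy => ha.differentiableAt_warpingFunction hy _)
    (fun y hy i hi => ha.pderiv_warpingFunction_eq_zero hy hI ?_)
    (ha.piecewise_mem {I} hx hp) hp fun i hi => Set.piecewise_eq_of_notMem _ _ _ hi
  rwa [Set.mem_preimage.1 hi]

theorem pderiv_metric_div_warpingFunction (ha : IsAdapted U g b lam α e) (hx : x ∈ U) (hI : I ≠ 0)
    (j l : {j // b j = I}) (hi : b i ≠ I) :
    pderiv i (fun y => g y j l / warpingFunction b lam (e I) y) x = 0 := by
  have hjI : b j.1 ≠ 0 := j.2.symm ▸ hI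
  have hij : ¬ SameEigenspace b i j.1 := by
    rintro (rfl | ⟨h, -⟩)
    exacts [hi j.2, hi (h.trans j.2)]
  refine pderiv_div_eq_zero_of_log (ha.metric.differentiableAt hx _ _)
    (ha.differentiableAt_warpingFunction hx _) (ha.warpingFunction_ne_zero hx hI)
    (ha.pderiv_metric_of_not_sameEigenspace hx (.inr ⟨j.2.trans l.2.symm, hjI⟩) hij) ?_
  rw [ha.lam_const x hx j hjI, j.2]
  exact ha.pderiv_warpingFunction hx hI i

theorem metric_eq_warped (ha : IsAdapted U g b lam α e) (hx : x ∈ U) (hp : p ∈ U) (hI : I ≠ 0)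
    (j l : {j // b j = I}) :
    g x j l = warpingFunction b lam (e I) x / warpingFunction b lam (e I) p *
      leafMetric b I p g (restrictTo b I x) j l := by
  classical
  have hquot : g x j l / warpingFunction b lam (e I) x =
      g (leafPoint b I p (restrictTo b I x)) j l /
        warpingFunction b lam (e I) (leafPoint b I p (restrictTo b I x)) := by
    rw [leafPoint_restrictTo]
    refine eq_of_pderiv_eq_zero (s := b ⁻¹' {I}ᶜ)
      (f := fun y => g y j l / warpingFunction b lam (e I) y)
      ha.metric.isOpen ha.connected (fun x hx y hy => ha.piecewise_mem {I}ᶜ hx hy)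
      (fun y hy => ?_) (fun y hy i hi => ha.pderiv_metric_div_warpingFunction hy hI j l hi)
      hx (ha.piecewise_mem {I} hx hp) fun i hi => ?_
    · simp only [div_eq_mul_inv]
      exact (ha.metric.differentiableAt hy _ _).fun_mul
        ((ha.differentiableAt_warpingFunction hy _).fun_inv (ha.warpingFunction_ne_zero hy hI))
    · exact (Set.piecewise_eq_of_mem (b ⁻¹' {I}) x p (not_not.1 hi)).symm
  rw [ha.warpingFunction_leafPoint hx hp hI,
    div_eq_iff (ha.warpingFunction_ne_zero hx hI)] at hquot
  rw [hquot, div_mul_comm, leafMetric, Matrix.submatrix_apply]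

theorem isOrthogonal (ha : IsAdapted U g b lam α e) {p : Fin (k + 1) → ι → ℝ}
    (hp : ∀ I, p I ∈ U)
    (ho : ∀ I, I ≠ 0 → IsOrthogonal (leafDomain b I (p I) U) (leafMetric b I (p I) g)) :
    IsOrthogonal U g := by
  intro x hx i j hij
  by_cases h : SameEigenspace b i j
  · obtain ⟨hb, hi⟩ := h.resolve_left hij
    have hj : b j ≠ 0 := hb ▸ hi
    refine (ha.metric_eq_warped hx (hp (b j)) hj ⟨i, hb⟩ ⟨j, rfl⟩).trans ?_
    rw [ho (b j) hj _ (ha.leafPoint_mem (hp _) hx) _ _ (Subtype.coe_ne_coe.1 hij), mul_zero]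
  · exact ha.metric_eq_zero x hx i j h

end IsAdapted

/-! ### The Lamé equations of adapted coordinates -/

theorem IsOrthogonal.leafMetric {ι : Type} {U : Set (ι → ℝ)}
    {g : (ι → ℝ) → Matrix ι ι ℝ} {k : ℕ} {b : ι → Fin (k + 1)} {I : Fin (k + 1)} {p : ι → ℝ}
    (ho : IsOrthogonal U g) : IsOrthogonal (leafDomain b I p U) (leafMetric b I p g) :=
  fun _ hy _ _ hij => ho _ hy _ _ (Subtype.coe_ne_coe.2 hij)

namespace IsAdapted

variable {ι : Type} [Fintype ι] [DecidableEq ι] {U : Set (ι → ℝ)} {g : (ι → ℝ) → Matrix ι ι ℝ}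
  {k : ℕ} {b : ι → Fin (k + 1)} {lam α : (ι → ℝ) → ι → ℝ} {e : Fin (k + 1) → ℝ}
  {I : Fin (k + 1)} {x p : ι → ℝ} {i j l : ι}

theorem pderiv_logLame (ha : IsAdapted U g b lam α e) (ho : IsOrthogonal U g) (hx : x ∈ U)
    (h : ¬ SameEigenspace b j i) :
    pderiv j (logLame g i) x = α x j / (lam x j - lam x i) / 2 := by
  rw [ho.pderiv_logLame ha.metric hx, ha.pderiv_metric_of_not_sameEigenspace hx (.inl rfl) h]
  have := ho.diag_ne_zero ha.metric hx i
  field_simp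

theorem pderiv_alpha_eq_zero (ha : IsAdapted U g b lam α e) (hx : x ∈ U) (hlj : l ≠ j) :
    pderiv l (fun y => α y j) x = 0 := by
  have hU := ha.metric.isOpen
  have hα : Set.EqOn (fun y => α y j) (pderiv j fun z => lam z j) U := fun y hy => by
    simp [ha.pderiv_lam y hy]
  rw [pderiv_congr_of_eqOn hU hα hx,
    pderiv_comm (((ha.lam_smooth j).contDiffAt (hU.mem_nhds hx)).of_le
      (WithTop.coe_le_coe.2 le_top))]
  exact pderiv_eq_zero_of_eqOn_const hU
    (fun y hy => (ha.pderiv_lam y hy j l).trans (if_neg hlj.symm)) hx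

theorem differentiableAt_alpha (ha : IsAdapted U g b lam α e) (hx : x ∈ U) (j : ι) :
    DifferentiableAt ℝ (fun y => α y j) x := by
  have hU := ha.metric.isOpen
  have hsmooth := (contDiffOn_pderiv hU (ha.lam_smooth j) j).congr
    fun y hy => show α y j = pderiv j (fun z => lam z j) y by simp [ha.pderiv_lam y hy]
  exact (hsmooth.contDiffAt (hU.mem_nhds hx)).differentiableAt (by simp)

theorem pderiv_pderiv_logLame_eq_zero (ha : IsAdapted U g b lam α e) (ho : IsOrthogonal U g)
    (hx : x ∈ U) (h : ¬ SameEigenspace b j i) (hli : l ≠ i) (hlj : l ≠ j) :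
    pderiv l (pderiv j (logLame g i)) x = 0 := by
  have hlam := ha.differentiableAt_lam hx
  have hsub := ha.lam_sub_ne_zero hx h
  have hquot : pderiv l (fun y => α y j / (lam y j - lam y i)) x = 0 :=
    pderiv_div_eq_zero_of_log (μ := 0) (ha.differentiableAt_alpha hx j)
      ((hlam j).fun_sub (hlam i)) hsub (by rw [ha.pderiv_alpha_eq_zero hx hlj, zero_mul]) (by
        rw [pderiv_sub (hlam j) (hlam i), ha.pderiv_lam x hx, ha.pderiv_lam x hx,
          if_neg hlj.symm, if_neg hli.symm, sub_zero, zero_mul])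
  have hdiff : DifferentiableAt ℝ (fun y => α y j / (lam y j - lam y i)) x := by
    simp only [div_eq_mul_inv]
    exact (ha.differentiableAt_alpha hx j).fun_mul (((hlam j).fun_sub (hlam i)).fun_inv hsub)
  rw [pderiv_congr_of_eqOn ha.metric.isOpen (fun y hy => ha.pderiv_logLame ho hy h) hx,
    pderiv_div_const hdiff, hquot, zero_div]

theorem pderiv_logLame_eq_leaf (ha : IsAdapted U g b lam α e) (ho : IsOrthogonal U g)
    (hx : x ∈ U) (hp : p ∈ U) (hI : I ≠ 0) (i j : {j // b j = I}) :
    pderiv j.1 (logLame g i.1) x =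
      pderiv j (logLame (leafMetric b I p g) i) (restrictTo b I x) := by
  have hmem := ha.leafPoint_mem (I := I) hp hx
  have hG := ha.isMetricOn_leafMetric (I := I) (p := p)
  have hGi := hG.differentiableAt hmem i i
  have hw := ha.differentiableAt_warpingFunction hx (e I)
  set w := warpingFunction b lam (e I)
  have hj : pderiv j.1 (fun y => g y i.1 i.1) x =
      w x / w p * pderiv j (fun y => leafMetric b I p g y i i) (restrictTo b I x) := by
    have hquot : DifferentiableAt ℝ (fun y => w y / w p) x := by
      simpa only [div_eq_mul_inv] using hw.mul_const _
    have hwj : pderiv j.1 (fun y => w y / w p) x = 0 := by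
      rw [pderiv_div_const hw, ha.pderiv_warpingFunction_eq_zero hx hI (j.2.symm ▸ hI), zero_div]
    rw [pderiv_congr_of_eqOn ha.metric.isOpen (fun y hy => ha.metric_eq_warped hy hp hI i i) hx,
      pderiv_mul (h := fun y => leafMetric b I p g (restrictTo b I y) i i) hquot
        (hGi.comp x (contDiff_restrictTo.differentiable (by simp) x)),
      hwj, pderiv_comp_restrictTo hGi, dif_pos j.2, zero_mul, zero_add]
  have hr : w x / w p ≠ 0 :=
    div_ne_zero (ha.warpingFunction_ne_zero hx hI) (ha.warpingFunction_ne_zero hp hI)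
  rw [ho.pderiv_logLame ha.metric hx, ho.leafMetric.pderiv_logLame hG hmem, hj,
    ha.metric_eq_warped hx hp hI i i, mul_left_comm, mul_div_mul_left _ _ hr]

theorem lameEquation_of_sameEigenspace (ha : IsAdapted U g b lam α e) (ho : IsOrthogonal U g)
    (hx : x ∈ U) (hp : p ∈ U) (hI : I ≠ 0)
    (hl : SatisfiesLame (leafDomain b I p U) (leafMetric b I p g)) {i j l : {j // b j = I}}
    (hij : i ≠ j) (hil : i ≠ l) (hjl : j ≠ l) : LameEquation g i.1 j.1 l.1 x := by
  have hmem := ha.leafPoint_mem (I := I) hp hx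
  have hG := ha.isMetricOn_leafMetric (I := I) (p := p)
  have hsmooth := contDiffOn_pderiv hG.isOpen (ho.leafMetric.contDiffOn_logLame hG i) j
  have hsecond := pderiv_congr_of_eqOn (i := l.1) ha.metric.isOpen
    (fun y hy => ha.pderiv_logLame_eq_leaf ho hy hp hI i j) hx
  rw [pderiv_comp_restrictTo
    ((hsmooth.contDiffAt (hG.isOpen.mem_nhds hmem)).differentiableAt (by simp)),
    dif_pos l.2] at hsecond
  rw [LameEquation, hsecond]
  simp only [ha.pderiv_logLame_eq_leaf ho hx hp hI]
  exact hl _ hmem i j l hij hil hjl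

theorem lameEquation_of_not_sameEigenspace (ha : IsAdapted U g b lam α e)
    (ho : IsOrthogonal U g) (hx : x ∈ U) (hil : i ≠ l) (hjl : j ≠ l)
    (h : ¬ SameEigenspace b j i) : LameEquation g i j l x := by
  rw [LameEquation, ha.pderiv_pderiv_logLame_eq_zero ho hx h hil.symm hjl.symm, zero_add]
  by_cases hli : SameEigenspace b l i
  · have hjl' : ¬ SameEigenspace b j l := fun h' => h (h'.trans hli)
    rw [ha.pderiv_logLame ho hx h, ha.pderiv_logLame ho hx hjl',
      ha.pderiv_logLame ho hx (mt SameEigenspace.symm hjl'), (ha.lam_eq_iff x hx l i).2 hli,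
      ha.alpha_eq_zero x hx l (hli.ne_zero hil.symm)]
    ring
  rw [ha.pderiv_logLame ho hx h, ha.pderiv_logLame ho hx hli]
  by_cases hjl' : SameEigenspace b j l
  · rw [ha.alpha_eq_zero x hx j (hjl'.ne_zero hjl),
      ha.alpha_eq_zero x hx l (hjl'.symm.ne_zero hjl.symm)]
    ring
  · rw [ha.pderiv_logLame ho hx hjl', ha.pderiv_logLame ho hx (mt SameEigenspace.symm hjl')]
    have := ha.lam_sub_ne_zero hx h
    have := ha.lam_sub_ne_zero hx hli
    have := ha.lam_sub_ne_zero hx hjl'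
    have := ha.lam_sub_ne_zero hx (mt SameEigenspace.symm hjl')
    field_simp
    ring

theorem satisfiesLame (ha : IsAdapted U g b lam α e) (ho : IsOrthogonal U g)
    {p : Fin (k + 1) → ι → ℝ} (hp : ∀ I, p I ∈ U)
    (hl : ∀ I, I ≠ 0 → SatisfiesLame (leafDomain b I (p I) U) (leafMetric b I (p I) g)) :
    SatisfiesLame U g := by
  intro x hx i j l hij hil hjl
  by_cases hji : SameEigenspace b j i
  · by_cases hli : SameEigenspace b l i
    · have hj : b j = b i := (hji.resolve_left hij.symm).1
      have hl' : b l = b i := (hli.resolve_left hil.symm).1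
      have hi : b i ≠ 0 := hj ▸ hji.ne_zero hij.symm
      exact ha.lameEquation_of_sameEigenspace ho hx (hp (b i)) hi (hl _ hi)
        (i := ⟨i, rfl⟩) (j := ⟨j, hj⟩) (l := ⟨l, hl'⟩) (Subtype.coe_ne_coe.1 hij)
        (Subtype.coe_ne_coe.1 hil) (Subtype.coe_ne_coe.1 hjl)
    · exact (ho.lameEquation_comm ha.metric hx).1
        (ha.lameEquation_of_not_sameEigenspace ho hx hij hjl.symm hli)
  · exact ha.lameEquation_of_not_sameEigenspace ho hx hil hjl hji

end IsAdapted

/-! ### Separated momenta -/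

/-- Near `x₀` and `c₀`, the functions `p i (x i) c` are the derivatives of the summands of a
separated complete integral of the Hamilton-Jacobi equation of the diagonal metric `g`, with
energy `E c`. -/
structure IsSeparatedMomentaAt {ι : Type} [Fintype ι] [DecidableEq ι]
    (g : (ι → ℝ) → Matrix ι ι ℝ) (x₀ c₀ : ι → ℝ) (p : ι → ℝ → (ι → ℝ) → ℝ)
    (E : (ι → ℝ) → ℝ) : Prop where
  smooth : ∀ i, ∀ᶠ q in 𝓝 (x₀ i, c₀), ContDiffAt ℝ ∞ (fun q : ℝ × (ι → ℝ) => p i q.1 q.2) q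
  eqn : ∀ᶠ q : (ι → ℝ) × (ι → ℝ) in 𝓝 (x₀, c₀),
    (1 / 2) * ∑ i, p i (q.1 i) q.2 ^ 2 / g q.1 i i = E q.2
  complete : (Matrix.of fun i j => pderiv j (p i (x₀ i)) c₀).det ≠ 0

/-- Near every point of `U` there are separated momenta for the diagonal metric `g`. -/
def HasSeparatedMomenta {ι : Type} [Fintype ι] [DecidableEq ι] (U : Set (ι → ℝ))
    (g : (ι → ℝ) → Matrix ι ι ℝ) : Prop :=
  ∀ x₀ ∈ U, ∃ c₀ p E, IsSeparatedMomentaAt g x₀ c₀ p E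

section SeparatedMomenta

variable {ι : Type} [Fintype ι] [DecidableEq ι] {U : Set (ι → ℝ)} {g : (ι → ℝ) → Matrix ι ι ℝ}
  {x x₀ c₀ : ι → ℝ} {p : ι → ℝ → (ι → ℝ) → ℝ} {E : (ι → ℝ) → ℝ}

theorem pderiv_sum_separated {w : ι → ℝ → ℝ} {w' : ι → ℝ}
    (hw : ∀ i, HasDerivAt (w i) (w' i) (x i)) (i : ι) :
    pderiv i (fun y => ∑ j, w j (y j)) x = w' i := by
  have hd (j : ι) : HasFDerivAt (fun y : ι → ℝ => w j (y j))
      (w' j • ContinuousLinearMap.proj (R := ℝ) (φ := fun _ : ι => ℝ) j) x :=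
    (hw j).comp_hasFDerivAt x (hasFDerivAt_apply (𝕜 := ℝ) j x)
  rw [pderiv_sum fun j _ => (hd j).differentiableAt]
  simp only [pderiv, (hd _).fderiv]
  simp [Pi.single_apply]

theorem continuous_pderiv_slice {F : ℝ × (ι → ℝ) → ℝ} (hF : ContDiff ℝ ∞ F) (j : ι) :
    Continuous fun q : ℝ × (ι → ℝ) => pderiv j (fun c => F (q.1, c)) q.2 := by
  have hslice (q : ℝ × (ι → ℝ)) :
      pderiv j (fun c => F (q.1, c)) q.2 = fderiv ℝ F q (0, Pi.single j 1) := by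
    have hcomp := (HasFDerivAt.comp (g := F) (f := fun c => (q.1, c)) q.2
      (hF.differentiable (by simp) q).hasFDerivAt
      (hasFDerivAt_prodMk_right (𝕜 := ℝ) q.1 q.2)).fderiv
    exact congrArg (fun T => T (Pi.single j 1)) hcomp
  simp only [hslice]
  exact (hF.continuous_fderiv (by simp)).clm_apply continuous_const

theorem IsOrthogonal.sum_inv_mul_mul (ho : IsOrthogonal U g) (hg : IsMetricOn U g) (hx : x ∈ U)
    (v : ι → ℝ) : ∑ i, ∑ j, (g x)⁻¹ i j * v i * v j = ∑ i, v i ^ 2 / g x i i := by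
  rw [ho.inv_eq_diagonal hg hx]
  simp only [Matrix.diagonal_apply, ite_mul, zero_mul, Finset.sum_ite_eq, Finset.mem_univ, if_true]
  exact Finset.sum_congr rfl fun i _ => by ring

theorem IsSeparatedMomentaAt.eventually_contDiffAt_energy
    (h : IsSeparatedMomentaAt g x₀ c₀ p E) : ∀ᶠ c in 𝓝 c₀, ContDiffAt ℝ ∞ E c := by
  have hE : ∀ᶠ c in 𝓝 c₀, (1 / 2) * ∑ i, p i (x₀ i) c ^ 2 / g x₀ i i = E c :=
    (Continuous.prodMk_right x₀).continuousAt.eventually h.eqn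
  have hp : ∀ᶠ c in 𝓝 c₀, ∀ i, ContDiffAt ℝ ∞ (p i (x₀ i)) c := by
    refine Filter.eventually_all.2 fun i => ?_
    filter_upwards [(Continuous.prodMk_right (x₀ i)).continuousAt.eventually (h.smooth i)]
      with c hc
    exact hc.comp c (contDiffAt_const.prodMk contDiffAt_id)
  filter_upwards [hE.eventually_nhds, hp] with c hEc hpc
  refine ContDiffAt.congr_of_eventuallyEq ?_ (hEc.mono fun _ => Eq.symm)
  exact contDiffAt_const.mul (ContDiffAt.sum fun i _ => ((hpc i).pow 2).div_const _)

theorem IsSeparatedMomentaAt.eventually_det_ne_zero (h : IsSeparatedMomentaAt g x₀ c₀ p E)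
    {F : ι → ℝ × (ι → ℝ) → ℝ} (hF : ∀ i, ContDiff ℝ ∞ (F i))
    (hFp : ∀ i, F i =ᶠ[𝓝 (x₀ i, c₀)] fun q => p i q.1 q.2) :
    ∀ᶠ q : (ι → ℝ) × (ι → ℝ) in 𝓝 (x₀, c₀),
      (Matrix.of fun i j => pderiv j (fun c => F i (q.1 i, c)) q.2).det ≠ 0 := by
  have hcont : Continuous fun q : (ι → ℝ) × (ι → ℝ) =>
      (Matrix.of fun i j => pderiv j (fun c => F i (q.1 i, c)) q.2).det :=
    Continuous.matrix_det <| continuous_matrix fun i j =>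
      (continuous_pderiv_slice (hF i) j).comp
        (f := fun q : (ι → ℝ) × (ι → ℝ) => (q.1 i, q.2)) (by fun_prop)
  refine hcont.continuousAt.eventually_ne ?_
  convert h.complete using 5 with i j
  exact pderiv_congr ((Continuous.prodMk_right (x₀ i)).continuousAt.eventually (hFp i))

theorem HasSeparatedMomenta.isSeparable (hs : HasSeparatedMomenta U g) (ho : IsOrthogonal U g)
    (hg : IsMetricOn U g) : IsSeparable U g := by
  intro x₀ hx₀
  obtain ⟨c₀, p, E, h⟩ := hs x₀ hx₀
  choose F hF hFp using fun i => exists_contDiff_eventuallyEq (h.smooth i)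
  let W (i : ι) (t : ℝ) (c : ι → ℝ) : ℝ := ∫ s in x₀ i..t, F i (s, c)
  have hW (c x : ι → ℝ) (i : ι) : pderiv i (fun y => ∑ j, W j (y j) c) x = F i (x i, c) :=
    pderiv_sum_separated (fun j => intervalIntegral.integral_hasDerivAt_right
      (((hF j).continuous.comp (Continuous.prodMk_left c)).intervalIntegrable _ _)
      (((hF j).continuous.comp (Continuous.prodMk_left c)).stronglyMeasurableAtFilter _ _)
      ((hF j).continuous.comp (Continuous.prodMk_left c)).continuousAt) i
  have hnear : ∀ᶠ q : (ι → ℝ) × (ι → ℝ) in 𝓝 (x₀, c₀), q.1 ∈ U ∧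
      (∀ i, F i (q.1 i, q.2) = p i (q.1 i) q.2) ∧
      (1 / 2) * ∑ i, p i (q.1 i) q.2 ^ 2 / g q.1 i i = E q.2 ∧
      (Matrix.of fun i j => pderiv j (fun c => F i (q.1 i, c)) q.2).det ≠ 0 := by
    refine (continuousAt_fst.eventually (hg.isOpen.mem_nhds hx₀)).and
      (.and (Filter.eventually_all.2 fun i => ?_) (h.eqn.and (h.eventually_det_ne_zero hF hFp)))
    have hi : Continuous fun q : (ι → ℝ) × (ι → ℝ) => (q.1 i, q.2) := by fun_prop
    exact (hi.tendsto (x₀, c₀)).eventually (hFp i)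
  obtain ⟨δ, hδ, hball⟩ := Metric.eventually_nhds_iff_ball.1 hnear
  simp only [← ball_prod_same, Set.mem_prod, and_imp, Prod.forall] at hball
  refine ⟨Metric.ball x₀ δ, Metric.isOpen_ball, Metric.mem_ball_self hδ,
    fun x hx => (hball x c₀ hx (Metric.mem_ball_self hδ)).1, Metric.ball c₀ δ,
    Metric.isOpen_ball, ⟨c₀, Metric.mem_ball_self hδ⟩, W, E, ?_, fun x hx c hc => ?_,
    fun x hx c hc => ?_⟩
  · exact ContDiff.contDiffOn <| ContDiff.sum fun i _ =>
      (contDiff_parametric_primitive (hF i) (x₀ i)).comp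
        (f := fun q : (ι → ℝ) × (ι → ℝ) => (q.1 i, q.2)) (by fun_prop)
  · obtain ⟨hxU, hFpx, heq, -⟩ := hball x c hx hc
    simp only [hW]
    rw [ho.sum_inv_mul_mul hg hxU, ← heq]
    simp only [hFpx]
  · simp only [hW]
    exact (hball x c hx hc).2.2.2

end SeparatedMomenta

/-! ### Identities from Lagrange interpolation -/

section Lagrange

variable {F ι κ : Type*} [Field F] [DecidableEq ι] {A : Finset ι} {N : Finset κ} {v w c : ι → F}
  {e h : κ → F}

theorem sum_prod_sub_div_prod_sub (hv : Set.InjOn v A) (w : ι → F) {j : ι} (hj : j ∈ A) :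
    ∑ a ∈ A, (∏ m ∈ A.erase j, (v a - w m)) / ∏ m ∈ A.erase a, (v a - v m) = 1 := by
  have hcard : (A.erase j).card = A.card - 1 := Finset.card_erase_of_mem hj
  have hdegree : (Lagrange.nodal (A.erase j) w).degree < A.card := by
    rw [Lagrange.degree_nodal, hcard]
    exact_mod_cast Nat.sub_lt (Finset.card_pos.2 ⟨j, hj⟩) one_pos
  have hlead := Lagrange.coeff_eq_sum hv hdegree
  simp only [Lagrange.eval_nodal] at hlead
  rw [← hlead, ← hcard, ← Lagrange.natDegree_nodal (s := A.erase j) (v := w)]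
  exact Lagrange.nodal_monic.coeff_natDegree

theorem sum_one_div_mul_prod_sub (hv : Set.InjOn v A) {s : F} (hs : ∀ a ∈ A, s - v a ≠ 0) :
    ∑ a ∈ A, 1 / (s - v a) / ∏ m ∈ A.erase a, (v a - v m) =
      1 / ∏ a ∈ A, (s - v a) - if A.Nonempty then 0 else 1 := by
  split_ifs with hA
  · have hone := congrArg (Polynomial.eval s) (Lagrange.sum_basis hv hA)
    simp only [Polynomial.eval_finsetSum, Lagrange.basis, Polynomial.eval_prod,
      Lagrange.basisDivisor, Polynomial.eval_mul, Polynomial.eval_C, Polynomial.eval_sub,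
      Polynomial.eval_X, Polynomial.eval_one, Finset.prod_mul_distrib] at hone
    rw [sub_zero, eq_div_iff (Finset.prod_ne_zero_iff.2 hs), Finset.sum_mul]
    refine Eq.trans (Finset.sum_congr rfl fun a ha => ?_) hone
    rw [← Finset.mul_prod_erase A _ ha, Finset.prod_inv_distrib]
    have := hs a ha
    field_simp
  · simp [Finset.not_nonempty_iff_eq_empty.1 hA]

/-- The rational function of `s` whose value at the `a`-th simple eigenvalue is, up to a factor
depending on the `a`-th coordinate only, the square of the `a`-th separated momentum. Here `c j` are
the free parameters and `h I` the contributions of the factors with eigenvalues `e I`. The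
polynomial part is written in the basis of Lagrange polynomials with nodes `w`. -/
def separationFunction (A : Finset ι) (N : Finset κ) (w c : ι → F) (e h : κ → F) (s : F) : F :=
  ∑ j ∈ A, c j * ∏ m ∈ A.erase j, (s - w m) - ∑ I ∈ N, h I / (e I - s)

theorem sum_separationFunction_div (hv : Set.InjOn v A) (he : ∀ I ∈ N, ∀ a ∈ A, e I - v a ≠ 0) :
    ∑ a ∈ A, separationFunction A N w c e h (v a) / ∏ r ∈ A.erase a, (v a - v r) =
      ∑ j ∈ A, c j -
        ∑ I ∈ N, h I * (1 / ∏ a ∈ A, (e I - v a) - if A.Nonempty then 0 else 1) := by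
  simp only [separationFunction, sub_div, Finset.sum_div, Finset.sum_sub_distrib]
  congr 1
  · rw [Finset.sum_comm]
    refine Finset.sum_congr rfl fun j hj => ?_
    simp only [mul_div_assoc, ← Finset.mul_sum, sum_prod_sub_div_prod_sub hv w hj, mul_one]
  · rw [Finset.sum_comm]
    refine Finset.sum_congr rfl fun I hI => ?_
    rw [← sum_one_div_mul_prod_sub hv (he I hI), Finset.mul_sum]
    exact Finset.sum_congr rfl fun a _ => by rw [← mul_div_assoc, mul_one_div]

theorem separationFunction_apply_node {a : ι} (ha : a ∈ A) :
    separationFunction A N w c e h (w a) =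
      c a * ∏ m ∈ A.erase a, (w a - w m) - ∑ I ∈ N, h I / (e I - w a) := by
  rw [separationFunction, Finset.sum_eq_single_of_mem a ha fun j _ hj => ?_]
  rw [Finset.prod_eq_zero (Finset.mem_erase.2 ⟨hj.symm, ha⟩) (sub_self _), mul_zero]

end Lagrange

section SeparationFunction

variable {ι κ : Type*} [DecidableEq ι] {A : Finset ι} {N : Finset κ} {w : ι → ℝ} {e : κ → ℝ}

theorem contDiffAt_separationFunction {X : Type*} [NormedAddCommGroup X] [NormedSpace ℝ X]
    {n : WithTop ℕ∞} {c : X → ι → ℝ} {h : X → κ → ℝ} {s : X → ℝ} {x : X}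
    (hc : ∀ j ∈ A, ContDiffAt ℝ n (fun y => c y j) x)
    (hh : ∀ I ∈ N, ContDiffAt ℝ n (fun y => h y I) x) (hs : ContDiffAt ℝ n s x)
    (he : ∀ I ∈ N, e I - s x ≠ 0) :
    ContDiffAt ℝ n (fun y => separationFunction A N w (c y) e (h y) (s y)) x :=
  .sub (.sum fun j hj => (hc j hj).mul (contDiffAt_prod fun _ _ => hs.sub contDiffAt_const))
    (.sum fun I hI => (hh I hI).div (contDiffAt_const.sub hs) (he I hI))

end SeparationFunction

theorem pderiv_coord {ι : Type} [Finite ι] [DecidableEq ι] (i a : ι) (x : ι → ℝ) :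
    pderiv i (fun y => y a) x = if a = i then 1 else 0 := by
  have := Fintype.ofFinite ι
  rw [pderiv, (hasFDerivAt_apply (𝕜 := ℝ) a x).fderiv]
  simp [Pi.single_apply]

theorem pderiv_separationFunction_node {ι κ : Type} [Finite ι] [DecidableEq ι] {A : Finset ι}
    {N : Finset κ} {w c : ι → ℝ} {e : κ → ℝ} {h : (ι → ℝ) → κ → ℝ} {a j : ι} (ha : a ∈ A)
    (hh : ∀ I ∈ N, DifferentiableAt ℝ (fun y => h y I) c)
    (hhj : ∀ I ∈ N, pderiv j (fun y => h y I) c = 0) :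
    pderiv j (fun y => separationFunction A N w y e (h y) (w a)) c =
      if a = j then ∏ m ∈ A.erase a, (w a - w m) else 0 := by
  have := Fintype.ofFinite ι
  have hdiv : ∀ I ∈ N, DifferentiableAt ℝ (fun y => h y I / (e I - w a)) c := fun I hI => by
    simpa only [div_eq_mul_inv] using (hh I hI).mul_const _
  have hcoord : DifferentiableAt ℝ (fun y : ι → ℝ => y a) c := differentiableAt_apply a c
  simp only [separationFunction_apply_node ha]
  rw [pderiv_sub (hcoord.mul_const _) (.fun_sum hdiv), pderiv_mul hcoord (differentiableAt_const _),
    pderiv_const, pderiv_coord, pderiv_sum hdiv,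
    Finset.sum_eq_zero fun I hI => by rw [pderiv_div_const (hh I hI), hhj I hI, zero_div]]
  split_ifs <;> ring

/-! ### The metric of `M_0` -/

theorem eventually_eq_update {ι : Type} [Finite ι] [DecidableEq ι] {f : (ι → ℝ) → ℝ} {a : ι}
    {x₀ : ι → ℝ} (hf : ∀ᶠ x in 𝓝 x₀, DifferentiableAt ℝ f x)
    (h0 : ∀ᶠ x in 𝓝 x₀, ∀ i ≠ a, pderiv i f x = 0) :
    ∀ᶠ x in 𝓝 x₀, f x = f (Function.update x₀ a (x a)) := by
  have := Fintype.ofFinite ι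
  obtain ⟨δ, hδ, hball⟩ := Metric.eventually_nhds_iff_ball.1 (hf.and h0)
  have hpiecewise (s : Set ι) [DecidablePred (· ∈ s)] : ∀ x ∈ Metric.ball x₀ δ,
      ∀ y ∈ Metric.ball x₀ δ, s.piecewise x y ∈ Metric.ball x₀ δ := by
    rw [ball_pi x₀ hδ]
    exact fun x hx y hy => Set.piecewise_mem_pi s hx hy
  filter_upwards [Metric.ball_mem_nhds x₀ hδ] with x hx
  have hx₀ := Metric.mem_ball_self (x := x₀) hδ
  rw [← Set.piecewise_singleton]
  exact eq_of_pderiv_eq_zero (s := {a}ᶜ) Metric.isOpen_ball (convex_ball x₀ δ).isPreconnected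
    (hpiecewise _) (fun y hy => (hball y hy).1) (fun y hy => (hball y hy).2) hx
    (hpiecewise {a} x hx x₀ hx₀) fun i hi =>
      (Set.piecewise_eq_of_mem _ _ _ (Set.notMem_compl_iff.1 hi)).symm

/-- The product of the differences between the `a`-th and the other simple eigenvalues; up to a
function of the `a`-th coordinate it is the `a`-th diagonal component of the metric. -/
def eigenvalueProduct {ι : Type} [Fintype ι] [DecidableEq ι] {k : ℕ} (b : ι → Fin (k + 1))
    (lam : (ι → ℝ) → ι → ℝ) (a : ι) (x : ι → ℝ) : ℝ :=
  ∏ r ∈ (simpleIndices b).erase a, (lam x a - lam x r)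

/-- Near `x₀` each simple eigenvalue `lam x a` is a function `m a` of its own coordinate, and the
metric components of `M_0` are functions `ψ a` of their own coordinates times the products of the
eigenvalue differences. -/
structure IsSeparatedFormAt {ι : Type} [Fintype ι] [DecidableEq ι] (g : (ι → ℝ) → Matrix ι ι ℝ)
    {k : ℕ} (b : ι → Fin (k + 1)) (lam : (ι → ℝ) → ι → ℝ) (x₀ : ι → ℝ) (m ψ : ι → ℝ → ℝ) :
    Prop where
  smooth_eigenvalue : ∀ a, b a = 0 → ∀ᶠ t in 𝓝 (x₀ a), ContDiffAt ℝ ∞ (m a) t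
  smooth_factor : ∀ a, b a = 0 → ∀ᶠ t in 𝓝 (x₀ a), ContDiffAt ℝ ∞ (ψ a) t
  eigenvalue : ∀ᶠ x in 𝓝 x₀, ∀ a, b a = 0 → lam x a = m a (x a)
  metric : ∀ᶠ x in 𝓝 x₀, ∀ a, b a = 0 → g x a a = ψ a (x a) * eigenvalueProduct b lam a x

namespace IsAdapted

variable {ι : Type} [Fintype ι] [DecidableEq ι] {U : Set (ι → ℝ)} {g : (ι → ℝ) → Matrix ι ι ℝ}
  {k : ℕ} {b : ι → Fin (k + 1)} {lam α : (ι → ℝ) → ι → ℝ} {e : Fin (k + 1) → ℝ}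
  {x x₀ : ι → ℝ} {i a : ι}

theorem injOn_lam (ha : IsAdapted U g b lam α e) (hx : x ∈ U) :
    Set.InjOn (lam x) (simpleIndices b) := by
  intro r hr s _ hrs
  by_contra hne
  exact ((ha.lam_eq_iff x hx r s).1 hrs).ne_zero hne (mem_simpleIndices.1 hr)

theorem lam_sub_lam_ne_zero (ha : IsAdapted U g b lam α e) (hx : x ∈ U) (ha0 : b a = 0) :
    ∀ r ∈ (simpleIndices b).erase a, lam x a - lam x r ≠ 0 := fun _ hr =>
  sub_ne_zero.2 fun h => Finset.ne_of_mem_erase hr <|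
    (ha.injOn_lam hx (mem_simpleIndices.2 ha0) (Finset.mem_of_mem_erase hr) h).symm

theorem eigenvalueProduct_ne_zero (ha : IsAdapted U g b lam α e) (hx : x ∈ U) (ha0 : b a = 0) :
    eigenvalueProduct b lam a x ≠ 0 :=
  Finset.prod_ne_zero_iff.2 (ha.lam_sub_lam_ne_zero hx ha0)

theorem contDiffOn_eigenvalueProduct (ha : IsAdapted U g b lam α e) (a : ι) :
    ContDiffOn ℝ ∞ (eigenvalueProduct b lam a) U :=
  contDiffOn_prod fun r _ => (ha.lam_smooth a).sub (ha.lam_smooth r)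

theorem contDiffOn_metric_div_eigenvalueProduct (ha : IsAdapted U g b lam α e) (ha0 : b a = 0) :
    ContDiffOn ℝ ∞ (fun y => g y a a / eigenvalueProduct b lam a y) U :=
  (ha.metric.smooth a a).div (ha.contDiffOn_eigenvalueProduct a)
    fun _ hx => ha.eigenvalueProduct_ne_zero hx ha0

theorem pderiv_lam_eq_zero (ha : IsAdapted U g b lam α e) (hx : x ∈ U) (hia : i ≠ a) :
    pderiv i (fun y => lam y a) x = 0 := by
  rw [ha.pderiv_lam x hx, if_neg hia.symm]

theorem pderiv_eigenvalueProduct (ha : IsAdapted U g b lam α e) (hx : x ∈ U) (ha0 : b a = 0)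
    (hia : i ≠ a) : pderiv i (eigenvalueProduct b lam a) x =
      α x i / (lam x i - lam x a) * eigenvalueProduct b lam a x := by
  refine (ha.pderiv_prod_sub_lam hx (ha.differentiableAt_lam hx a) (ha.pderiv_lam_eq_zero hx hia)
    (ha.lam_sub_lam_ne_zero hx ha0)).trans ?_
  by_cases hi : b i = 0
  · simp [eigenvalueProduct, mem_simpleIndices, hi, hia]
  · simp [ha.alpha_eq_zero x hx i hi]

theorem pderiv_metric_div_eigenvalueProduct (ha : IsAdapted U g b lam α e) (hx : x ∈ U)
    (ha0 : b a = 0) (hia : i ≠ a) :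
    pderiv i (fun y => g y a a / eigenvalueProduct b lam a y) x = 0 :=
  pderiv_div_eq_zero_of_log (ha.metric.differentiableAt hx a a)
    (((ha.contDiffOn_eigenvalueProduct a).contDiffAt
      (ha.metric.isOpen.mem_nhds hx)).differentiableAt (by simp))
    (ha.eigenvalueProduct_ne_zero hx ha0)
    (ha.pderiv_metric_of_not_sameEigenspace hx (.inl rfl) fun h => h.symm.ne_zero hia.symm ha0)
    (ha.pderiv_eigenvalueProduct hx ha0 hia)

theorem eventually_eq_comp_coordinate (ha : IsAdapted U g b lam α e) (hx₀ : x₀ ∈ U)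
    {f : (ι → ℝ) → ℝ} (hf : ContDiffOn ℝ ∞ f U)
    (h0 : ∀ x ∈ U, ∀ i ≠ a, pderiv i f x = 0) :
    (∀ᶠ t in 𝓝 (x₀ a), ContDiffAt ℝ ∞ (fun t => f (Function.update x₀ a t)) t) ∧
      ∀ᶠ x in 𝓝 x₀, f x = f (Function.update x₀ a (x a)) := by
  have hU := ha.metric.isOpen.eventually_mem hx₀
  have hsmooth : ∀ᶠ x in 𝓝 x₀, ContDiffAt ℝ ∞ f x :=
    hU.mono fun x hx => hf.contDiffAt (ha.metric.isOpen.mem_nhds hx)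
  refine ⟨?_, eventually_eq_update (hsmooth.mono fun x hx => hx.differentiableAt (by simp))
    (hU.mono h0)⟩
  have hupdate : Filter.Tendsto (Function.update x₀ a) (𝓝 (x₀ a)) (𝓝 x₀) := by
    simpa using (contDiff_update (𝕜 := ℝ) ∞ x₀ a).continuous.tendsto (x₀ a)
  filter_upwards [hupdate.eventually hsmooth] with t ht
  exact ht.comp t (contDiff_update ∞ x₀ a).contDiffAt

theorem exists_isSeparatedFormAt (ha : IsAdapted U g b lam α e) (hx₀ : x₀ ∈ U) :
    ∃ m ψ : ι → ℝ → ℝ, IsSeparatedFormAt g b lam x₀ m ψ := by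
  have hlam (a : ι) := ha.eventually_eq_comp_coordinate hx₀ (ha.lam_smooth a)
    fun x hx i hi => ha.pderiv_lam_eq_zero hx hi
  have hmetric (a : ι) (ha0 : b a = 0) := ha.eventually_eq_comp_coordinate hx₀
    (ha.contDiffOn_metric_div_eigenvalueProduct ha0)
    fun x hx i hi => ha.pderiv_metric_div_eigenvalueProduct hx ha0 hi
  refine ⟨fun a t => lam (Function.update x₀ a t) a, fun a t =>
    g (Function.update x₀ a t) a a / eigenvalueProduct b lam a (Function.update x₀ a t),
    fun a _ => (hlam a).1, fun a ha0 => (hmetric a ha0).1, ?_, ?_⟩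
  · exact Filter.eventually_all.2 fun a => (hlam a).2.mono fun _ hx _ => hx
  · refine Filter.eventually_all.2 fun a => Filter.eventually_imp_distrib_left.2 fun ha0 => ?_
    filter_upwards [(hmetric a ha0).2, ha.metric.isOpen.eventually_mem hx₀] with x hx hxU
    exact (div_eq_iff (ha.eigenvalueProduct_ne_zero hxU ha0)).1 hx

end IsAdapted

/-! ### Momenta of the associated product -/

section ProductMomenta

variable {ι : Type} {k : ℕ}

/-- The contribution of the `I`-th factor, with warping constant `r I` and energy `Ef I`, to the
separated Hamilton-Jacobi equations of the simple coordinates. -/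
def factorEnergy (b : ι → Fin (k + 1)) (r : Fin (k + 1) → ℝ)
    (Ef : ∀ I, ({j // b j = I} → ℝ) → ℝ) (c : ι → ℝ) (I : Fin (k + 1)) : ℝ :=
  2 * r I * Ef I (restrictTo b I c)

variable [Fintype ι] [DecidableEq ι]

/-- The square of the separated momentum of the `a`-th coordinate on `M_0`, where `m` and `ψ` are as
in `IsSeparatedFormAt`, and `h c I` is the contribution of the `I`-th factor. -/
noncomputable def simpleMomentumSq (b : ι → Fin (k + 1)) (m ψ : ι → ℝ → ℝ) (w : ι → ℝ)
    (e : Fin (k + 1) → ℝ) (h : (ι → ℝ) → Fin (k + 1) → ℝ) (a : ι) (t : ℝ) (c : ι → ℝ) : ℝ :=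
  ψ a t * separationFunction (simpleIndices b) (Finset.univ.erase 0) w c e (h c) (m a t)

/-- The separated momenta of the product: square roots of `simpleMomentumSq` on `M_0`, and the
given momenta `pf I` on the other factors. -/
noncomputable def productMomenta (b : ι → Fin (k + 1)) (m ψ : ι → ℝ → ℝ) (w : ι → ℝ)
    (e : Fin (k + 1) → ℝ) (h : (ι → ℝ) → Fin (k + 1) → ℝ)
    (pf : ∀ I, {j // b j = I} → ℝ → ({j // b j = I} → ℝ) → ℝ) (i : ι) (t : ℝ) (c : ι → ℝ) : ℝ :=
  if b i = 0 then √(simpleMomentumSq b m ψ w e h i t c)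
  else pf (b i) ⟨i, rfl⟩ t (restrictTo b (b i) c)

/-- The energy of `productMomenta`. The two cases come from the constant term in
`sum_one_div_mul_prod_sub`. -/
noncomputable def productEnergy (b : ι → Fin (k + 1)) (h : (ι → ℝ) → Fin (k + 1) → ℝ)
    (c : ι → ℝ) : ℝ :=
  (1 / 2) * (∑ a ∈ simpleIndices b, c a +
    if (simpleIndices b).Nonempty then 0 else ∑ I ∈ Finset.univ.erase 0, h c I)

variable {b : ι → Fin (k + 1)} {m ψ : ι → ℝ → ℝ} {w c : ι → ℝ} {e r : Fin (k + 1) → ℝ}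
  {h : (ι → ℝ) → Fin (k + 1) → ℝ} {pf : ∀ I, {j // b j = I} → ℝ → ({j // b j = I} → ℝ) → ℝ}
  {Ef : ∀ I, ({j // b j = I} → ℝ) → ℝ} {I : Fin (k + 1)}

theorem productMomenta_simple {a : ι} (ha : b a = 0) :
    productMomenta b m ψ w e h pf a = fun t c => √(simpleMomentumSq b m ψ w e h a t c) := by
  funext t c
  rw [productMomenta, if_pos ha]

theorem productMomenta_factor (hI : I ≠ 0) (j : {j // b j = I}) :
    productMomenta b m ψ w e h pf j = fun t c => pf I j t (restrictTo b I c) := by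
  obtain ⟨j, rfl⟩ := j
  funext t c
  rw [productMomenta, if_neg hI]

theorem simpleMomentumSq_eq_mul_separationFunction {a : ι} {s t : ℝ} (hs : s = m a t) :
    simpleMomentumSq b m ψ w e h a t = fun c =>
      ψ a t * separationFunction (simpleIndices b) (Finset.univ.erase 0) w c e (h c) s := by
  funext c
  rw [simpleMomentumSq, hs]

omit [DecidableEq ι] in
theorem contDiffAt_factorEnergy (hE : ContDiffAt ℝ ∞ (Ef I) (restrictTo b I c)) :
    ContDiffAt ℝ ∞ (fun y => factorEnergy b r Ef y I) c :=
  contDiffAt_const.mul (hE.comp c contDiff_restrictTo.contDiffAt)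

omit [Fintype ι] in
theorem pderiv_factorEnergy_eq_zero [Finite ι]
    (hE : DifferentiableAt ℝ (Ef I) (restrictTo b I c)) {j : ι} (hj : b j ≠ I) :
    pderiv j (fun y => factorEnergy b r Ef y I) c = 0 := by
  have := Fintype.ofFinite ι
  have hd : DifferentiableAt ℝ (fun y => Ef I (restrictTo b I y)) c :=
    hE.comp c (contDiff_restrictTo.differentiable (by simp) c)
  simp only [factorEnergy]
  rw [pderiv_mul (differentiableAt_const _) hd, pderiv_const, pderiv_comp_restrictTo hE,
    dif_neg hj, mul_zero, zero_mul, add_zero]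

end ProductMomenta

namespace IsAdapted

variable {ι : Type} [Fintype ι] [DecidableEq ι] {U : Set (ι → ℝ)} {g : (ι → ℝ) → Matrix ι ι ℝ}
  {k : ℕ} {b : ι → Fin (k + 1)} {lam α : (ι → ℝ) → ι → ℝ} {e r : Fin (k + 1) → ℝ}
  {m ψ : ι → ℝ → ℝ} {w x x₀ c c₀ : ι → ℝ} {h : (ι → ℝ) → Fin (k + 1) → ℝ}
  {pf : ∀ I, {j // b j = I} → ℝ → ({j // b j = I} → ℝ) → ℝ}
  {Ef : ∀ I, ({j // b j = I} → ℝ) → ℝ} {p : Fin (k + 1) → ι → ℝ} {I : Fin (k + 1)} {a : ι}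

theorem eventually_contDiffAt_simpleMomentumSq (ha : IsAdapted U g b lam α e) (hx₀ : x₀ ∈ U)
    (hform : IsSeparatedFormAt g b lam x₀ m ψ)
    (hh : ∀ I ≠ 0, ∀ᶠ c in 𝓝 c₀, ContDiffAt ℝ ∞ (fun c => h c I) c) (ha0 : b a = 0) :
    ∀ᶠ q : ℝ × (ι → ℝ) in 𝓝 (x₀ a, c₀),
      ContDiffAt ℝ ∞ (fun q => simpleMomentumSq b m ψ w e h a q.1 q.2) q := by
  have hm := hform.smooth_eigenvalue a ha0
  have hsub : ∀ᶠ t in 𝓝 (x₀ a), ∀ I ≠ 0, e I - m a t ≠ 0 := by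
    refine Filter.eventually_all.2 fun I => Filter.eventually_imp_distrib_left.2 fun hI => ?_
    have hx₀I : e I - m a (x₀ a) ≠ 0 := by
      rw [← hform.eigenvalue.self_of_nhds a ha0]
      exact ha.sub_lam_ne_zero hx₀ hI ha0
    exact (continuousAt_const.sub hm.self_of_nhds.continuousAt).eventually_ne hx₀I
  have hh' : ∀ᶠ c in 𝓝 c₀, ∀ I ≠ 0, ContDiffAt ℝ ∞ (fun c => h c I) c :=
    Filter.eventually_all.2 fun I => Filter.eventually_imp_distrib_left.2 (hh I)
  have hfst := continuousAt_fst (p := (x₀ a, c₀))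
  filter_upwards [hfst.eventually hm, hfst.eventually (hform.smooth_factor a ha0),
    hfst.eventually hsub, continuousAt_snd.eventually hh'] with q hmq hψq hsubq hhq
  refine (hψq.comp q contDiffAt_fst).mul (contDiffAt_separationFunction (fun j _ => ?_)
    (fun I hI => ?_) (hmq.comp q contDiffAt_fst) fun I hI => hsubq I (Finset.ne_of_mem_erase hI))
  · exact ContDiff.contDiffAt (by fun_prop)
  · exact (hhq I (Finset.ne_of_mem_erase hI)).comp q contDiffAt_snd

theorem eventually_contDiffAt_productMomenta (ha : IsAdapted U g b lam α e) (hx₀ : x₀ ∈ U)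
    (hform : IsSeparatedFormAt g b lam x₀ m ψ)
    (hh : ∀ I ≠ 0, ∀ᶠ c in 𝓝 c₀, ContDiffAt ℝ ∞ (fun c => h c I) c)
    (hpos : ∀ a, b a = 0 → 0 < simpleMomentumSq b m ψ w e h a (x₀ a) c₀)
    (hpf : ∀ I ≠ 0, ∀ j, ∀ᶠ q in 𝓝 (restrictTo b I x₀ j, restrictTo b I c₀),
      ContDiffAt ℝ ∞ (fun q : ℝ × ({j // b j = I} → ℝ) => pf I j q.1 q.2) q) (i : ι) :
    ∀ᶠ q : ℝ × (ι → ℝ) in 𝓝 (x₀ i, c₀),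
      ContDiffAt ℝ ∞ (fun q => productMomenta b m ψ w e h pf i q.1 q.2) q := by
  by_cases hi : b i = 0
  · have hsq := ha.eventually_contDiffAt_simpleMomentumSq hx₀ hform hh (w := w) hi
    simp only [productMomenta_simple hi]
    filter_upwards [hsq, hsq.self_of_nhds.continuousAt.eventually_const_lt (hpos i hi)]
      with q hq hqpos
    exact hq.sqrt hqpos.ne'
  · have hrestrict : ContDiff ℝ ∞ fun q : ℝ × (ι → ℝ) => (q.1, restrictTo b (b i) q.2) :=
      contDiff_fst.prodMk (contDiff_restrictTo.comp contDiff_snd)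
    simp only [productMomenta_factor (b := b) hi ⟨i, rfl⟩]
    filter_upwards [(hrestrict.continuous.tendsto (x₀ i, c₀)).eventually (hpf (b i) hi ⟨i, rfl⟩)]
      with q hq
    exact hq.comp q hrestrict.contDiffAt

theorem sum_simpleMomentumSq_div (ha : IsAdapted U g b lam α e) (ho : IsOrthogonal U g)
    (hx : x ∈ U) (hlam : ∀ a, b a = 0 → lam x a = m a (x a))
    (hmetric : ∀ a, b a = 0 → g x a a = ψ a (x a) * eigenvalueProduct b lam a x) :
    ∑ a ∈ simpleIndices b, simpleMomentumSq b m ψ w e h a (x a) c / g x a a =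
      ∑ a ∈ simpleIndices b, c a - ∑ I ∈ Finset.univ.erase 0, h c I *
        (1 / warpingFunction b lam (e I) x - if (simpleIndices b).Nonempty then 0 else 1) := by
  refine Eq.trans (Finset.sum_congr rfl fun a has => ?_) (sum_separationFunction_div (w := w)
    (ha.injOn_lam hx) fun I hI a has =>
      ha.sub_lam_ne_zero hx (Finset.ne_of_mem_erase hI) (mem_simpleIndices.1 has))
  have ha0 := mem_simpleIndices.1 has
  have hψ : ψ a (x a) ≠ 0 :=
    left_ne_zero_of_mul (hmetric a ha0 ▸ ho.diag_ne_zero ha.metric hx a)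
  rw [hmetric a ha0, simpleMomentumSq, mul_div_mul_left _ _ hψ, ← hlam a ha0, eigenvalueProduct]

theorem sum_factor_div (ha : IsAdapted U g b lam α e) (hx : x ∈ U) (hp : p I ∈ U) (hI : I ≠ 0)
    (hr : r I = warpingFunction b lam (e I) (p I))
    (heqn : (1 / 2) * ∑ j, pf I j (x j) (restrictTo b I c) ^ 2 /
      leafMetric b I (p I) g (restrictTo b I x) j j = Ef I (restrictTo b I c)) :
    ∑ j, pf I j (x j) (restrictTo b I c) ^ 2 / g x j j =
      factorEnergy b r Ef c I / warpingFunction b lam (e I) x := by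
  simp only [ha.metric_eq_warped hx hp hI, factorEnergy, hr, ← heqn, Finset.mul_sum, Finset.sum_div]
  refine Finset.sum_congr rfl fun j _ => ?_
  have hp0 := ha.warpingFunction_ne_zero hp hI
  field_simp

theorem sum_productMomenta_sq_div (ha : IsAdapted U g b lam α e) (ho : IsOrthogonal U g)
    (hp : ∀ I, p I ∈ U) (hx : x ∈ U) (hlam : ∀ a, b a = 0 → lam x a = m a (x a))
    (hmetric : ∀ a, b a = 0 → g x a a = ψ a (x a) * eigenvalueProduct b lam a x)
    (hr : ∀ I, r I = warpingFunction b lam (e I) (p I))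
    (hpos : ∀ a, b a = 0 → 0 < simpleMomentumSq b m ψ w e (factorEnergy b r Ef) a (x a) c)
    (heqn : ∀ I ≠ 0, (1 / 2) * ∑ j, pf I j (x j) (restrictTo b I c) ^ 2 /
      leafMetric b I (p I) g (restrictTo b I x) j j = Ef I (restrictTo b I c)) :
    (1 / 2) * ∑ i, productMomenta b m ψ w e (factorEnergy b r Ef) pf i (x i) c ^ 2 / g x i i =
      productEnergy b (factorEnergy b r Ef) c := by
  have hsimple : ∑ a : {a // b a = 0},
        productMomenta b m ψ w e (factorEnergy b r Ef) pf a (x a) c ^ 2 / g x a a =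
      ∑ a ∈ simpleIndices b,
        simpleMomentumSq b m ψ w e (factorEnergy b r Ef) a (x a) c / g x a a := by
    rw [Finset.sum_subtype (simpleIndices b) fun _ => mem_simpleIndices]
    refine Finset.sum_congr rfl fun a _ => ?_
    rw [productMomenta_simple a.2, Real.sq_sqrt (hpos a a.2).le]
  have hfactor : ∀ I ∈ Finset.univ.erase 0,
      ∑ j : {j // b j = I},
          productMomenta b m ψ w e (factorEnergy b r Ef) pf j (x j) c ^ 2 / g x j j =
        factorEnergy b r Ef c I / warpingFunction b lam (e I) x := fun I hI => by
    have hI0 := Finset.ne_of_mem_erase hI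
    rw [← ha.sum_factor_div hx (hp I) hI0 (hr I) (heqn I hI0)]
    exact Finset.sum_congr rfl fun j _ => by rw [productMomenta_factor hI0]
  rw [productEnergy, ← Fintype.sum_fiberwise b, ← Finset.add_sum_erase _ _ (Finset.mem_univ 0),
    hsimple, Finset.sum_congr rfl hfactor, ha.sum_simpleMomentumSq_div ho hx hlam hmetric]
  simp only [mul_sub, Finset.sum_sub_distrib, mul_one_div]
  split_ifs <;> simp only [mul_zero, mul_one, Finset.sum_const_zero] <;> ring

theorem differentiableAt_separationFunction (ha : IsAdapted U g b lam α e) (hx : x ∈ U)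
    (ha0 : b a = 0) (hh : ∀ I ≠ 0, ContDiffAt ℝ ∞ (fun c => h c I) c₀) :
    DifferentiableAt ℝ (fun c => separationFunction (simpleIndices b) (Finset.univ.erase 0) w c e
      (h c) (lam x a)) c₀ :=
  (contDiffAt_separationFunction (c := id) (fun j _ => (contDiff_apply ℝ ℝ j).contDiffAt)
    (fun I hI => hh I (Finset.ne_of_mem_erase hI)) contDiffAt_const fun _ hI =>
      ha.sub_lam_ne_zero hx (Finset.ne_of_mem_erase hI) ha0).differentiableAt (by simp)

theorem pderiv_simpleMomentumSq (ha : IsAdapted U g b lam α e) (hx₀ : x₀ ∈ U) (ha0 : b a = 0)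
    (hlam : lam x₀ a = m a (x₀ a)) (hh : ∀ I ≠ 0, ContDiffAt ℝ ∞ (fun c => h c I) c₀) {j : ι}
    (hhj : ∀ I ≠ 0, pderiv j (fun c => h c I) c₀ = 0) :
    pderiv j (simpleMomentumSq b m ψ (lam x₀) e h a (x₀ a)) c₀ =
      if a = j then ψ a (x₀ a) * eigenvalueProduct b lam a x₀ else 0 := by
  rw [simpleMomentumSq_eq_mul_separationFunction hlam, pderiv_mul (differentiableAt_const _)
    (ha.differentiableAt_separationFunction hx₀ ha0 hh), pderiv_const,
    pderiv_separationFunction_node (mem_simpleIndices.2 ha0)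
    (fun I hI => (hh I (Finset.ne_of_mem_erase hI)).differentiableAt (by simp))
    fun I hI => hhj I (Finset.ne_of_mem_erase hI), eigenvalueProduct]
  split_ifs <;> ring

theorem pderiv_productMomenta_simple (ha : IsAdapted U g b lam α e) (hx₀ : x₀ ∈ U) (ha0 : b a = 0)
    (hlam : lam x₀ a = m a (x₀ a)) (hE : ∀ I ≠ 0, ContDiffAt ℝ ∞ (Ef I) (restrictTo b I c₀))
    (hpos : 0 < simpleMomentumSq b m ψ (lam x₀) e (factorEnergy b r Ef) a (x₀ a) c₀) {j : ι}
    (hj : b j = 0) :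
    pderiv j (productMomenta b m ψ (lam x₀) e (factorEnergy b r Ef) pf a (x₀ a)) c₀ =
      if a = j then 1 / (2 * √(simpleMomentumSq b m ψ (lam x₀) e (factorEnergy b r Ef) a (x₀ a) c₀))
        * (ψ a (x₀ a) * eigenvalueProduct b lam a x₀) else 0 := by
  have hh : ∀ I ≠ 0, ContDiffAt ℝ ∞ (fun c => factorEnergy b r Ef c I) c₀ :=
    fun I hI => contDiffAt_factorEnergy (hE I hI)
  have hhj : ∀ I ≠ 0, pderiv j (fun c => factorEnergy b r Ef c I) c₀ = 0 := fun I hI =>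
    pderiv_factorEnergy_eq_zero ((hE I hI).differentiableAt (by simp)) (hj.trans_ne hI.symm)
  have hd : DifferentiableAt ℝ
      (simpleMomentumSq b m ψ (lam x₀) e (factorEnergy b r Ef) a (x₀ a)) c₀ := by
    rw [simpleMomentumSq_eq_mul_separationFunction hlam]
    exact (ha.differentiableAt_separationFunction hx₀ ha0 hh).const_mul _
  rw [productMomenta_simple ha0, pderiv_comp (Real.hasDerivAt_sqrt hpos.ne') hd,
    ha.pderiv_simpleMomentumSq hx₀ ha0 hlam hh hhj, mul_ite, mul_zero]

theorem exists_simpleMomentumSq_eq_one (ha : IsAdapted U g b lam α e) (hx₀ : x₀ ∈ U)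
    (hlam : ∀ a, b a = 0 → lam x₀ a = m a (x₀ a)) (hψ : ∀ a, b a = 0 → ψ a (x₀ a) ≠ 0)
    (cf : ∀ I, {j // b j = I} → ℝ) :
    ∃ c₀, (∀ I ≠ 0, restrictTo b I c₀ = cf I) ∧ ∀ a, b a = 0 →
      simpleMomentumSq b m ψ (lam x₀) e (factorEnergy b r Ef) a (x₀ a) c₀ = 1 := by
  let c₀ (i : ι) : ℝ := if b i = 0 then ((ψ i (x₀ i))⁻¹ + ∑ I ∈ Finset.univ.erase 0,
    2 * r I * Ef I (cf I) / (e I - lam x₀ i)) / eigenvalueProduct b lam i x₀ else cf (b i) ⟨i, rfl⟩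
  have hcf : ∀ I ≠ 0, restrictTo b I c₀ = cf I := by
    intro I hI
    funext ⟨j, hj⟩
    subst hj
    simp [restrictTo, c₀, hI]
  have henergy : ∀ I ∈ Finset.univ.erase 0, factorEnergy b r Ef c₀ I = 2 * r I * Ef I (cf I) :=
    fun I hI => by rw [factorEnergy, hcf I (Finset.ne_of_mem_erase hI)]
  refine ⟨c₀, hcf, fun a ha0 => ?_⟩
  have hc₀ : c₀ a * eigenvalueProduct b lam a x₀ = (ψ a (x₀ a))⁻¹ + ∑ I ∈ Finset.univ.erase 0,
      2 * r I * Ef I (cf I) / (e I - lam x₀ a) := by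
    simp only [c₀, if_pos ha0]
    exact div_mul_cancel₀ _ (ha.eigenvalueProduct_ne_zero hx₀ ha0)
  rw [simpleMomentumSq, ← hlam a ha0, separationFunction_apply_node (mem_simpleIndices.2 ha0),
    ← eigenvalueProduct, hc₀,
    Finset.sum_congr rfl fun I hI => congrArg (· / (e I - lam x₀ a)) (henergy I hI),
    add_sub_cancel_right, mul_inv_cancel₀ (hψ a ha0)]

theorem det_pderiv_productMomenta_ne_zero (ha : IsAdapted U g b lam α e) (hx₀ : x₀ ∈ U)
    (hlam : ∀ a, b a = 0 → lam x₀ a = m a (x₀ a))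
    (hpos : ∀ a, b a = 0 →
      0 < simpleMomentumSq b m ψ (lam x₀) e (factorEnergy b r Ef) a (x₀ a) c₀)
    (hE : ∀ I ≠ 0, ContDiffAt ℝ ∞ (Ef I) (restrictTo b I c₀))
    (hpf : ∀ I ≠ 0, ∀ j, DifferentiableAt ℝ (pf I j (x₀ j)) (restrictTo b I c₀))
    (hdet : ∀ I ≠ 0, (Matrix.of fun i j : {j // b j = I} =>
      pderiv j (pf I i (x₀ i)) (restrictTo b I c₀)).det ≠ 0) :
    (Matrix.of fun i j => pderiv j
      (productMomenta b m ψ (lam x₀) e (factorEnergy b r Ef) pf i (x₀ i)) c₀).det ≠ 0 := by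
  have hsimple : Matrix.toSquareBlock (Matrix.of fun i j => pderiv j
      (productMomenta b m ψ (lam x₀) e (factorEnergy b r Ef) pf i (x₀ i)) c₀) b 0 =
        Matrix.diagonal fun a : {a // b a = 0} =>
          1 / (2 * √(simpleMomentumSq b m ψ (lam x₀) e (factorEnergy b r Ef) a (x₀ a) c₀)) *
            (ψ a (x₀ a) * eigenvalueProduct b lam a x₀) := by
    ext a j
    exact (ha.pderiv_productMomenta_simple hx₀ a.2 (hlam a a.2) hE (hpos a a.2) j.2).trans
      (if_congr Subtype.ext_iff.symm rfl rfl)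
  have hfactor (I : Fin (k + 1)) (hI : I ≠ 0) (i : {j // b j = I}) (j : ι) :
      pderiv j (productMomenta b m ψ (lam x₀) e (factorEnergy b r Ef) pf i (x₀ i)) c₀ =
        if hj : b j = I then pderiv ⟨j, hj⟩ (pf I i (x₀ i)) (restrictTo b I c₀) else 0 := by
    rw [productMomenta_factor hI]
    exact pderiv_comp_restrictTo (hpf I hI i) j
  rw [Matrix.BlockTriangular.det_fintype (b := b), Finset.prod_ne_zero_iff]
  · intro I _
    by_cases hI : I = 0
    · rw [hI, hsimple, Matrix.det_diagonal, Finset.prod_ne_zero_iff]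
      exact fun a _ => mul_ne_zero
        (one_div_ne_zero (mul_ne_zero two_ne_zero (Real.sqrt_pos.2 (hpos a a.2)).ne'))
        (mul_ne_zero (left_ne_zero_of_mul (hpos a a.2).ne') (ha.eigenvalueProduct_ne_zero hx₀ a.2))
    · convert hdet I hI using 2
      ext i j
      exact (hfactor I hI i j).trans (dif_pos j.2)
  · intro i j hji
    exact (hfactor (b i) (Fin.ne_zero_of_lt hji) ⟨i, rfl⟩ j).trans (dif_neg hji.ne)

theorem eventually_productMomenta_eqn (ha : IsAdapted U g b lam α e) (ho : IsOrthogonal U g)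
    (hx₀ : x₀ ∈ U) (hp : ∀ I, p I ∈ U) (hform : IsSeparatedFormAt g b lam x₀ m ψ)
    (hr : ∀ I, r I = warpingFunction b lam (e I) (p I))
    (hE : ∀ I ≠ 0, ∀ᶠ c in 𝓝 c₀, ContDiffAt ℝ ∞ (fun c => factorEnergy b r Ef c I) c)
    (hpos : ∀ a, b a = 0 → 0 < simpleMomentumSq b m ψ w e (factorEnergy b r Ef) a (x₀ a) c₀)
    (heqn : ∀ I ≠ 0, ∀ᶠ q : (_ → ℝ) × (_ → ℝ) in 𝓝 (restrictTo b I x₀, restrictTo b I c₀),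
      (1 / 2) * ∑ j, pf I j (q.1 j) q.2 ^ 2 / leafMetric b I (p I) g q.1 j j = Ef I q.2) :
    ∀ᶠ q : (ι → ℝ) × (ι → ℝ) in 𝓝 (x₀, c₀),
      (1 / 2) * ∑ i, productMomenta b m ψ w e (factorEnergy b r Ef) pf i (q.1 i) q.2 ^ 2 /
        g q.1 i i = productEnergy b (factorEnergy b r Ef) q.2 := by
  have hpos' : ∀ᶠ q : (ι → ℝ) × (ι → ℝ) in 𝓝 (x₀, c₀), ∀ a, b a = 0 →
      0 < simpleMomentumSq b m ψ w e (factorEnergy b r Ef) a (q.1 a) q.2 := by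
    refine Filter.eventually_all.2 fun a => Filter.eventually_imp_distrib_left.2 fun ha0 => ?_
    have hcont := (ha.eventually_contDiffAt_simpleMomentumSq hx₀ hform hE (w := w)
      ha0).self_of_nhds.continuousAt
    have hcoord : Continuous fun q : (ι → ℝ) × (ι → ℝ) => (q.1 a, q.2) := by fun_prop
    exact (hcoord.tendsto (x₀, c₀)).eventually (hcont.eventually_const_lt (hpos a ha0))
  have heqn' : ∀ᶠ q : (ι → ℝ) × (ι → ℝ) in 𝓝 (x₀, c₀), ∀ I ≠ 0,
      (1 / 2) * ∑ j, pf I j (q.1 j) (restrictTo b I q.2) ^ 2 /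
        leafMetric b I (p I) g (restrictTo b I q.1) j j = Ef I (restrictTo b I q.2) := by
    refine Filter.eventually_all.2 fun I => Filter.eventually_imp_distrib_left.2 fun hI => ?_
    have hrestrict : Continuous fun q : (ι → ℝ) × (ι → ℝ) =>
        (restrictTo b I q.1, restrictTo b I q.2) :=
      contDiff_restrictTo.continuous.prodMap contDiff_restrictTo.continuous
    exact (hrestrict.tendsto (x₀, c₀)).eventually (heqn I hI)
  filter_upwards [continuousAt_fst.eventually (ha.metric.isOpen.eventually_mem hx₀),
    continuousAt_fst.eventually hform.eigenvalue, continuousAt_fst.eventually hform.metric,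
    hpos', heqn'] with q hx hlam hmetric hpos heqn
  exact ha.sum_productMomenta_sq_div ho hp hx hlam hmetric hr hpos heqn

theorem hasSeparatedMomenta (ha : IsAdapted U g b lam α e) (ho : IsOrthogonal U g)
    (hp : ∀ I, p I ∈ U)
    (hs : ∀ I ≠ 0, HasSeparatedMomenta (leafDomain b I (p I) U) (leafMetric b I (p I) g)) :
    HasSeparatedMomenta U g := by
  intro x₀ hx₀
  obtain ⟨m, ψ, hform⟩ := ha.exists_isSeparatedFormAt hx₀
  have hlam := hform.eigenvalue.self_of_nhds
  have hψ : ∀ a, b a = 0 → ψ a (x₀ a) ≠ 0 := fun a ha0 => left_ne_zero_of_mul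
    (hform.metric.self_of_nhds a ha0 ▸ ho.diag_ne_zero ha.metric hx₀ a)
  have hleaf (I : Fin (k + 1)) : ∃ cI pI EI, I ≠ 0 → IsSeparatedMomentaAt
      (leafMetric b I (p I) g) (restrictTo b I x₀) cI pI EI := by
    by_cases hI : I = 0
    · exact ⟨0, 0, 0, fun h => absurd hI h⟩
    · obtain ⟨cI, pI, EI, h⟩ := hs I hI _ (ha.leafPoint_mem (hp I) hx₀)
      exact ⟨cI, pI, EI, fun _ => h⟩
  let r (I : Fin (k + 1)) : ℝ := warpingFunction b lam (e I) (p I)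
  choose cf pf Ef hf using hleaf
  obtain ⟨c₀, hc₀, hone⟩ := ha.exists_simpleMomentumSq_eq_one hx₀ hlam hψ cf (Ef := Ef) (r := r)
  have hf₀ (I : Fin (k + 1)) (hI : I ≠ 0) : IsSeparatedMomentaAt (leafMetric b I (p I) g)
      (restrictTo b I x₀) (restrictTo b I c₀) (pf I) (Ef I) := hc₀ I hI ▸ hf I hI
  have hpos := fun a ha0 => (hone a ha0).symm ▸ one_pos (α := ℝ)
  have hE : ∀ I ≠ 0, ∀ᶠ c in 𝓝 c₀, ContDiffAt ℝ ∞ (fun c => factorEnergy b r Ef c I) c :=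
    fun I hI => ((contDiff_restrictTo.continuous.tendsto c₀).eventually
      (hf₀ I hI).eventually_contDiffAt_energy).mono fun _ => contDiffAt_factorEnergy
  refine ⟨c₀, productMomenta b m ψ (lam x₀) e (factorEnergy b r Ef) pf,
    productEnergy b (factorEnergy b r Ef), ?_, ?_, ?_⟩
  · exact ha.eventually_contDiffAt_productMomenta hx₀ hform hE hpos fun I hI => (hf₀ I hI).smooth
  · exact ha.eventually_productMomenta_eqn ho hx₀ hp hform (fun _ => rfl) hE hpos
      fun I hI => (hf₀ I hI).eqn
  · refine ha.det_pderiv_productMomenta_ne_zero hx₀ hlam hpos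
      (fun I hI => (hf₀ I hI).eventually_contDiffAt_energy.self_of_nhds) (fun I hI j => ?_)
      fun I hI => (hf₀ I hI).complete
    exact ((((hf₀ I hI).smooth j).self_of_nhds.comp (restrictTo b I c₀)
      (contDiffAt_const.prodMk contDiffAt_id)).differentiableAt (by simp))

end IsAdapted

/-! ### KEM coordinates -/

theorem IsKEM.isOrthogonal_and_hasSeparatedMomenta_and_satisfiesLame {ι : Type} [Fintype ι]
    [DecidableEq ι] {U : Set (ι → ℝ)} {g : (ι → ℝ) → Matrix ι ι ℝ} (h : IsKEM U g)
    (hg : IsMetricOn U g) : IsOrthogonal U g ∧ HasSeparatedMomenta U g ∧ SatisfiesLame U g := by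
  induction h with
  | ofOCT L oct _ b prod p mem _ ih =>
    obtain ⟨lam, α, e, ha⟩ := oct.toIsConcircular.exists_isAdapted hg prod
    have ih' := fun I hI => ih I hI ha.isMetricOn_leafMetric
    have ho := ha.isOrthogonal mem fun I hI => (ih' I hI).1
    exact ⟨ho, ha.hasSeparatedMomenta ho mem fun I hI => (ih' I hI).2.1,
      ha.satisfiesLame ho mem fun I hI => (ih' I hI).2.2⟩
  | ofLocal V nhd _ ih =>
    have ih' := fun x hx => ih x hx (hg.mono (nhd x hx).1 (nhd x hx).2.2)
    exact ⟨fun x hx => (ih' x hx).1 x (nhd x hx).2.1, fun x hx => (ih' x hx).2.1 x (nhd x hx).2.1,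
      fun x hx => (ih' x hx).2.2 x (nhd x hx).2.1⟩

theorem IsKEM.isOrthogonal_and_isSeparable_and_isDiagonalCurvature {ι : Type} [Fintype ι]
    [DecidableEq ι] {U : Set (ι → ℝ)} {g : (ι → ℝ) → Matrix ι ι ℝ} (h : IsKEM U g)
    (hg : IsMetricOn U g) : IsOrthogonal U g ∧ IsSeparable U g ∧ IsDiagonalCurvature U g := by
  obtain ⟨ho, hs, hl⟩ := h.isOrthogonal_and_hasSeparatedMomenta_and_satisfiesLame hg
  exact ⟨ho, hs.isSeparable ho hg, ho.isDiagonalCurvature hg hl⟩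

/-! ### The metric components in a coordinate system -/

section Manifold

variable {n : ℕ} {M : Type*} [TopologicalSpace M] [ChartedSpace (EuclideanSpace ℝ (Fin n)) M]
  [IsManifold (𝓡 n) ∞ M] {φ : OpenPartialHomeomorph M (Fin n → ℝ)}

theorem IsCoordinateSystem.contMDiffOn_coordVector (hφ : IsCoordinateSystem φ) (i : Fin n) :
    ContMDiffOn 𝓘(ℝ, Fin n → ℝ) (𝓡 n).tangent ∞ (fun y => (Bundle.TotalSpace.mk'
      (EuclideanSpace ℝ (Fin n)) (φ.symm y) (coordVector φ y i) : TangentBundle (𝓡 n) M))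
      φ.target := by
  have htangent := hφ.smooth_symm.contMDiffOn_tangentMapWithin (m := ∞) (by simp)
    φ.open_target.uniqueMDiffOn
  have hsingle : ContMDiff 𝓘(ℝ, Fin n → ℝ) (𝓘(ℝ, Fin n → ℝ)).tangent ∞
      (fun y : Fin n → ℝ => (Bundle.TotalSpace.mk' (Fin n → ℝ) y (Pi.single i 1 : Fin n → ℝ) :
        TangentBundle 𝓘(ℝ, Fin n → ℝ) (Fin n → ℝ))) :=
    contMDiff_vectorSpace_iff_contDiff.2 (contDiff_const (c := (Pi.single i 1 : Fin n → ℝ)))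
  refine (htangent.comp hsingle.contMDiffOn fun y hy => hy).congr fun y hy => ?_
  simp only [Function.comp, tangentMapWithin, coordVector]
  rw [mfderivWithin_of_isOpen φ.open_target hy]

theorem IsCoordinateSystem.contDiffOn_metricComponents (hφ : IsCoordinateSystem φ)
    (g : PseudoRiemannianMetric n M) (i j : Fin n) :
    ContDiffOn ℝ ∞ (fun y => metricComponents g φ y i j) φ.target := by
  rw [← contMDiffOn_iff_contDiffOn]
  intro y hy
  have hinner : ContMDiffWithinAt 𝓘(ℝ, Fin n → ℝ) ((𝓡 n).prod 𝓘(ℝ, ℝ)) ∞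
      (fun y ↦ Bundle.TotalSpace.mk' ℝ (E := Bundle.Trivial M ℝ) (φ.symm y)
        (g.inner (φ.symm y) (coordVector φ y i) (coordVector φ y j))) φ.target y := by
    apply ContMDiffWithinAt.clm_bundle_apply₂ (F₁ := EuclideanSpace ℝ (Fin n))
      (F₂ := EuclideanSpace ℝ (Fin n))
    · exact g.contMDiff.contMDiffAt.comp_contMDiffWithinAt y (hφ.smooth_symm y hy)
    · exact hφ.contMDiffOn_coordVector i y hy
    · exact hφ.contMDiffOn_coordVector j y hy
  exact (Bundle.contMDiffWithinAt_totalSpace.1 hinner).2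

omit [IsManifold (𝓡 n) ∞ M] in
theorem IsCoordinateSystem.mfderiv_apply_mfderiv_symm (hφ : IsCoordinateSystem φ)
    {y : Fin n → ℝ} (hy : y ∈ φ.target) (v : Fin n → ℝ) :
    mfderiv (𝓡 n) 𝓘(ℝ, Fin n → ℝ) φ (φ.symm y)
      (mfderiv 𝓘(ℝ, Fin n → ℝ) (𝓡 n) φ.symm y v) = v := by
  have hsymm : MDifferentiableAt 𝓘(ℝ, Fin n → ℝ) (𝓡 n) φ.symm y :=
    (hφ.smooth_symm.contMDiffAt (φ.open_target.mem_nhds hy)).mdifferentiableAt (by simp)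
  have hd : MDifferentiableAt (𝓡 n) 𝓘(ℝ, Fin n → ℝ) φ (φ.symm y) :=
    (hφ.smooth.contMDiffAt (φ.open_source.mem_nhds (φ.map_target hy))).mdifferentiableAt (by simp)
  have hcomp := mfderiv_comp y hd hsymm
  rw [(Filter.eventuallyEq_of_mem (φ.open_target.mem_nhds hy) φ.rightInvOn :
    φ ∘ φ.symm =ᶠ[nhds y] id).mfderiv_eq, mfderiv_id] at hcomp
  exact (DFunLike.congr_fun hcomp v).symm

omit [IsManifold (𝓡 n) ∞ M] in
theorem IsCoordinateSystem.exists_basis_eq_coordVector (hφ : IsCoordinateSystem φ)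
    {y : Fin n → ℝ} (hy : y ∈ φ.target) :
    ∃ β : Module.Basis (Fin n) ℝ (EuclideanSpace ℝ (Fin n)), ∀ i, β i = coordVector φ y i := by
  let T : (Fin n → ℝ) →ₗ[ℝ] EuclideanSpace ℝ (Fin n) :=
    (mfderiv 𝓘(ℝ, Fin n → ℝ) (𝓡 n) φ.symm y).toLinearMap
  have hT : Function.Injective T := Function.LeftInverse.injective
    (g := mfderiv (𝓡 n) 𝓘(ℝ, Fin n → ℝ) φ (φ.symm y)) (hφ.mfderiv_apply_mfderiv_symm hy)
  refine ⟨(Pi.basisFun ℝ (Fin n)).map (T.linearEquivOfInjective hT (by simp)), fun i => ?_⟩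
  rw [Module.Basis.map_apply, Pi.basisFun_apply]
  rfl

theorem IsCoordinateSystem.det_metricComponents_ne_zero (hφ : IsCoordinateSystem φ)
    (g : PseudoRiemannianMetric n M) {y : Fin n → ℝ} (hy : y ∈ φ.target) :
    (metricComponents g φ y).det ≠ 0 := by
  obtain ⟨β, hβ⟩ := hφ.exists_basis_eq_coordVector hy
  let B : LinearMap.BilinForm ℝ (EuclideanSpace ℝ (Fin n)) :=
    ContinuousLinearMap.toLinearMap₁₂ (g.inner (φ.symm y))
  have hB : B.Nondegenerate := (LinearMap.IsRefl.nondegenerate_iff_separatingLeft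
    (LinearMap.IsSymm.isRefl ⟨g.symm (φ.symm y)⟩)).2 (g.nondegenerate (φ.symm y))
  have hmatrix : LinearMap.BilinForm.toMatrix β B = metricComponents g φ y := by
    ext i j
    rw [LinearMap.BilinForm.toMatrix_apply, hβ, hβ]
    rfl
  exact hmatrix ▸ (LinearMap.BilinForm.nondegenerate_iff_det_ne_zero β).1 hB

theorem IsCoordinateSystem.isMetricOn_metricComponents (hφ : IsCoordinateSystem φ)
    (g : PseudoRiemannianMetric n M) : IsMetricOn φ.target (metricComponents g φ) where
  isOpen := φ.open_target
  smooth := hφ.contDiffOn_metricComponents g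
  symm _ _ _ _ := g.symm _ _ _
  det_ne_zero _ hy := hφ.det_metricComponents_ne_zero g hy

end Manifold

end KEM

theorem mainTheorem4 {n : ℕ} {M : Type*} [TopologicalSpace M]
    [ChartedSpace (EuclideanSpace ℝ (Fin n)) M] [IsManifold (𝓡 n) ∞ M]
    (g : KEM.PseudoRiemannianMetric n M) (φ : OpenPartialHomeomorph M (Fin n → ℝ))
    (hφ : KEM.IsCoordinateSystem φ)
    (hKEM : KEM.IsKEM φ.target (KEM.metricComponents g φ)) :
    KEM.IsOrthogonal φ.target (KEM.metricComponents g φ) ∧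
    KEM.IsSeparable φ.target (KEM.metricComponents g φ) ∧
    KEM.IsDiagonalCurvature φ.target (KEM.metricComponents g φ) :=
  hKEM.isOrthogonal_and_isSeparable_and_isDiagonalCurvature (hφ.isMetricOn_metricComponents g)
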